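/- Let $q$ be a power of a prime $p$ and let $\mathbb{F}_q((T^{-1}))$ be the field of Laurent series $\xi=\sum_{n\ge N}a_nT^{-n}$ over the finite field $\mathbb{F}_q$, with absolute value $|0|=0$ and $|\xi|=q^{-N}$ if $a_N\neq 0$, extended uniquely to the algebraic closure of $\mathbb{F}_q((T^{-1}))$. The height $H(P)$ of $P(X)\in(\mathbb{F}_q[T])[X]$ is the maximum of the absolute values of its coefficients. The height $H(\alpha)$ and the degree $\deg\alpha$ of $\alpha\in\overline{\mathbb{F}_q(T)}$ are those of its minimal polynomial over $\mathbb{F}_q[T]$, that is, of the unique non-constant irreducible primitive $P(X)\in(\mathbb{F}_q[T])[X]$ whose leading coefficient is monic in $T$ and with $P(\alpha)=0$. For integers $n,H\ge 1$ put $$w_n(\xi,H)=\min\{|P(\xi)| : P(X)\in(\mathbb{F}_q[T])[X],\ H(P)\le H,\ \deg_XP\le n,\ P(\xi)\ne 0\},$$ $$w_n^*(\xi,H)=\min\{|\xi-\alpha| : \alpha\in\overline{\mathbb{F}_q(T)},\ H(\alpha)\le H,\ \deg\alpha\le n,\ \alpha\ne\xi\},$$ $$w_n(\xi)=\limsup_{H\to\infty}\frac{-\log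 w_n(\xi,H)}{\log H},\qquad w_n^*(\xi)=\limsup_{H\to\infty}\frac{-\log\big(H\,w_n^*(\xi,H)\big)}{\log H}.$$ **Corollary 1.3.** For every $\xi\in\mathbb{F}_q((T^{-1}))$ the exponents $w_2(\xi)$ and $w_2^*(\xi)$ lie in $[0,+\infty]$, and they are either both finite or both infinite. The range of the function $w_2-w_2^*$, that is, the set of values $w_2(\xi)-w_2^*(\xi)$ over all $\xi\in\mathbb{F}_q((T^{-1}))$ for which these exponents are finite, is exactly the closed interval $[0,1]$. -/

import Mathlib

open scoped LaurentSeries NNReal Polynomial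

noncomputable section

namespace LaurentExponents

/-! `F` is a finite field with `q = Nat.card F` elements.  The field `F((T⁻¹))` is Mathlib's field
`F⸨X⸩` of formal Laurent series, its variable `X = single 1 1` playing the role of `T⁻¹`; thus
`ξ.coeff n` is the coefficient of `T⁻ⁿ` in `ξ`. -/

lemma valuation_laurent {F : Type*} [Field F] {ξ : F⸨X⸩} (hξ : ξ ≠ 0) :
    (Valued.v ξ : WithZero (Multiplicative ℤ)) = WithZero.exp (-ξ.order) := by
  apply le_antisymm
  · rw [LaurentSeries.valuation_le_iff_coeff_lt_eq_zero]
    exact fun n hn => HahnSeries.coeff_eq_zero_of_lt_order hn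
  · by_contra! h
    have h2 : (Valued.v ξ : WithZero (Multiplicative ℤ)) ≤ WithZero.exp (-(ξ.order + 1)) := by
      have h0 : (Valued.v ξ : WithZero (Multiplicative ℤ)) ≠ 0 := by simpa using hξ
      rw [← WithZero.exp_log h0] at h ⊢
      rw [WithZero.exp_lt_exp] at h
      rw [WithZero.exp_le_exp]
      omega
    rw [LaurentSeries.valuation_le_iff_coeff_lt_eq_zero] at h2
    exact hξ (HahnSeries.coeff_order_eq_zero.mp (h2 _ (by omega)))

section Field

variable (F : Type*) [Field F] [Finite F]

lemma one_lt_q : 1 < (Nat.card F : ℝ≥0) := by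
  exact_mod_cast Finite.one_lt_card

instance rankOneLaurent : (Valued.v : Valuation F⸨X⸩ (WithZero (Multiplicative ℤ))).RankOne where
  hom' := (WithZeroMulInt.toNNReal (one_lt_q F).ne_zero).comp
    MonoidWithZeroHom.ValueGroup₀.embedding
  strictMono' := (WithZeroMulInt.toNNReal_strictMono (one_lt_q F)).comp
    MonoidWithZeroHom.ValueGroup₀.embedding_strictMono
  exists_val_nontrivial := by
    obtain ⟨x, hx⟩ := LaurentSeries.valuation_surjective F (WithZero.exp 1)
    exact ⟨x, by simp [hx], by rw [hx, ← WithZero.exp_zero]; simp⟩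

/-- The absolute value on `F((T⁻¹))`, as a norm; `norm_laurent` below says that `‖ξ‖ = q ^ (-N)`
if `ξ = ∑_{n ≥ N} aₙ T⁻ⁿ` with `a_N ≠ 0`. -/
instance normedFieldLaurent : NormedField F⸨X⸩ :=
  Valued.toNormedField F⸨X⸩ (WithZero (Multiplicative ℤ))

variable {F}

lemma norm_laurent {ξ : F⸨X⸩} (hξ : ξ ≠ 0) : ‖ξ‖ = (Nat.card F : ℝ) ^ (-ξ.order) := by
  have h : ‖ξ‖ = WithZeroMulInt.toNNReal (one_lt_q F).ne_zero (Valued.v ξ) := by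
    rw [Valued.toNormedField.norm_def, ← Valuation.embedding_restrict Valued.v ξ]
    rfl
  have h0 : (Valued.v ξ : WithZero (Multiplicative ℤ)) ≠ 0 := by simpa using hξ
  rw [h, valuation_laurent hξ]
  simp [WithZeroMulInt.toNNReal_neg_apply, WithZero.exp]

/-- The embedding `F[T] → F((T⁻¹))`.  (Mathlib's own algebra structure of `F⸨X⸩` over `F[X]`
sends the polynomial variable to `X`, that is to `T⁻¹`, and is not used.) -/
def polyEmb : F[X] →+* F⸨X⸩ :=
  Polynomial.eval₂RingHom HahnSeries.C (HahnSeries.single (-1) 1)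

/-- The height of `P ∈ (F[T])[X]`: the maximum of the absolute values of its coefficients. -/
def height (P : F[X][X]) : ℝ≥0 :=
  P.support.sup fun i => ‖polyEmb (P.coeff i)‖₊

/-- The extension of the absolute value to the algebraic closure of `F((T⁻¹))`. -/
def absClosure (x : AlgebraicClosure F⸨X⸩) : ℝ :=
  spectralNorm F⸨X⸩ (AlgebraicClosure F⸨X⸩) x

/-- `P` is the minimal polynomial over `F[T]` of `α`: it is non-constant, irreducible and
primitive in `(F[T])[X]`, its leading coefficient is monic in `T`, and `P(α) = 0`.  The elements
`α` that have one are the elements of the algebraic closure of `F(T)`. -/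
def IsMinPoly (P : F[X][X]) (α : AlgebraicClosure F⸨X⸩) : Prop :=
  0 < P.natDegree ∧ Irreducible P ∧ P.IsPrimitive ∧ P.leadingCoeff.Monic ∧
    P.eval₂ ((algebraMap F⸨X⸩ (AlgebraicClosure F⸨X⸩)).comp polyEmb) α = 0

/-- `w_n(ξ, H)`, the minimum of the `|P(ξ)|` with `H(P) ≤ H`, `deg P ≤ n`, `P(ξ) ≠ 0`. -/
def minPolyValue (n : ℕ) (ξ : F⸨X⸩) (H : ℕ) : ℝ :=
  sInf {r : ℝ | ∃ P : F[X][X], height P ≤ H ∧ P.natDegree ≤ n ∧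
    P.eval₂ polyEmb ξ ≠ 0 ∧ r = ‖P.eval₂ polyEmb ξ‖}

/-- `w_n^*(ξ, H)`, the minimum of the `|ξ - α|` over the `α ≠ ξ` algebraic over `F(T)` with
`H(α) ≤ H` and `deg α ≤ n`, the height and the degree being those of the minimal polynomial. -/
def minAlgDist (n : ℕ) (ξ : F⸨X⸩) (H : ℕ) : ℝ :=
  sInf {r : ℝ | ∃ α : AlgebraicClosure F⸨X⸩,
    (∃ P : F[X][X], IsMinPoly P α ∧ height P ≤ H ∧ P.natDegree ≤ n) ∧
    α ≠ algebraMap F⸨X⸩ (AlgebraicClosure F⸨X⸩) ξ ∧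
    r = absClosure (algebraMap F⸨X⸩ (AlgebraicClosure F⸨X⸩) ξ - α)}

/-- The exponent `w_n(ξ) = limsup_{H → ∞} (-log w_n(ξ, H)) / log H`, possibly infinite. -/
def mahlerExp (n : ℕ) (ξ : F⸨X⸩) : EReal :=
  Filter.limsup (fun H : ℕ => ((-Real.log (minPolyValue n ξ H) / Real.log H : ℝ) : EReal))
    Filter.atTop

/-- The exponent `w_n^*(ξ) = limsup_{H → ∞} (-log (H w_n^*(ξ, H))) / log H`, possibly infinite. -/
def koksmaExp (n : ℕ) (ξ : F⸨X⸩) : EReal :=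
  Filter.limsup (fun H : ℕ => ((-Real.log (H * minAlgDist n ξ H) / Real.log H : ℝ) : EReal))
    Filter.atTop

end Field

end LaurentExponents
end

noncomputable section

namespace LaurentExponents

set_option linter.unusedSectionVars false

variable {F : Type*} [Field F] [Finite F]

/-! The bounds `koksmaExp_le_mahlerExp` and `mahlerExp_le_koksmaExp_add_one`, that is w₂* ≤ w₂ ≤ w₂*
+ 1, settle everything except surjectivity onto [0, 1]. Both rest on one fact: the discriminant of a
quadratic lies in F[T], so distinct roots α, β satisfy |a||α - β| ≥ 1. The first bound is |P(ξ)| ≪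
H(P)|ξ - α|. For the second, the root α nearest to ξ satisfies |ξ - α| ≤ |P(ξ)|, and a double root
is replaced by a linear polynomial of height at most √H (`exists_linear_of_disc_eq_zero`), which in
characteristic two covers inseparable quadratics as well.

The value 0 is attained at ξ = 0. For 0 < δ ≤ 1, ξ is a limit of quadratic α_j whose minimal
equations P_j have height q^h and conjugate roots at distance q^(-2m), where h = 2m + d and d = (1 -
δ)h + O(1) (`exists_closeQuadratic`). With |ξ - α_j| = q^(1 - Kh), one gets |P_j(ξ)| = q^(1 + d -
Kh). The P_j thus contribute K - 1 + δ to w₂ and K - 1 to w₂*. Any Q that is not a multiple of some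
P_j is controlled by its resultant with a suitable P_j (`one_le_norm_resultant`,
`neg_log_norm_eval_le`) and contributes at most K - 1 once K ≥ 16/δ + 2. -/

instance ultrametricLaurent : IsUltrametricDist F⸨X⸩ :=
  ⟨fun x y z => by
    have h := Valued.isNonarchimedean_norm F⸨X⸩ (WithZero (Multiplicative ℤ)) (x - y) (y - z)
    rw [dist_eq_norm, dist_eq_norm, dist_eq_norm, ← sub_add_sub_cancel x y z]
    exact h⟩

instance completeLaurent : @CompleteSpace F⸨X⸩
    (normedFieldLaurent F).toMetricSpace.toPseudoMetricSpace.toUniformSpace :=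
  (LaurentSeries.instLaurentSeriesComplete : CompleteSpace F⸨X⸩)

/-- The absolute value of `F((T⁻¹))` is nontrivial. -/
instance nontrivialLaurent : NontriviallyNormedField F⸨X⸩ where
  __ := normedFieldLaurent F
  non_trivial :=
    (Valued.toNontriviallyNormedField (L := F⸨X⸩) (Γ₀ := WithZero (Multiplicative ℤ))).non_trivial

/-- The algebraic closure of `F((T⁻¹))` with its absolute value. -/
instance normedFieldClosure : NormedField (AlgebraicClosure F⸨X⸩) :=
  spectralNorm.normedField F⸨X⸩ (AlgebraicClosure F⸨X⸩)

instance ultrametricClosure : IsUltrametricDist (AlgebraicClosure F⸨X⸩) :=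
  ⟨fun x y z => by
    have h := isNonarchimedean_spectralNorm (K := F⸨X⸩) (L := AlgebraicClosure F⸨X⸩) (x - y) (y - z)
    rw [dist_eq_norm, dist_eq_norm, dist_eq_norm, ← sub_add_sub_cancel x y z]
    exact h⟩

lemma norm_algebraMap_closure (x : F⸨X⸩) :
    ‖algebraMap F⸨X⸩ (AlgebraicClosure F⸨X⸩) x‖ = ‖x‖ :=
  spectralNorm_extends x

/-! ### Absolute values of elements of F[T] -/

lemma coeff_polyEmb (a : F[X]) (n : ℕ) : (polyEmb a).coeff (-(n : ℤ)) = a.coeff n := by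
  have h : ∀ (r : F) (k : ℕ), polyEmb (Polynomial.monomial k r) = HahnSeries.single (-(k : ℤ)) r := by
    intro r k
    simp [polyEmb, HahnSeries.single_pow, HahnSeries.C_apply]
  induction a using Polynomial.induction_on' with
  | add p q hp hq => simp [hp, hq]
  | monomial k r =>
    rw [h, HahnSeries.coeff_single, Polynomial.coeff_monomial]
    congr 1
    simp [eq_comm]

lemma polyEmb_injective : Function.Injective (polyEmb : F[X] →+* F⸨X⸩) := by
  intro a b h
  ext n
  rw [← coeff_polyEmb, ← coeff_polyEmb, h]

lemma one_lt_card_real (F : Type*) [Field F] [Finite F] : (1 : ℝ) < Nat.card F := by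
  exact_mod_cast Finite.one_lt_card

lemma norm_polyEmb {a : F[X]} (ha : a ≠ 0) : ‖polyEmb a‖ = (Nat.card F : ℝ) ^ a.natDegree := by
  have h0 : polyEmb a ≠ 0 := by
    rw [← map_zero (polyEmb (F := F))]
    exact fun h => ha (polyEmb_injective h)
  have ho : (polyEmb a).order = -(a.natDegree : ℤ) := by
    apply le_antisymm
    · apply HahnSeries.order_le_of_coeff_ne_zero
      rw [coeff_polyEmb]
      simpa using ha
    · by_contra! hlt
      apply HahnSeries.coeff_order_eq_zero.not.mpr h0
      obtain ⟨k, hk⟩ : ∃ k : ℕ, (polyEmb a).order = -(k : ℤ) := ⟨(-(polyEmb a).order).toNat, by omega⟩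
      rw [hk, coeff_polyEmb]
      exact Polynomial.coeff_eq_zero_of_natDegree_lt (by omega)
  rw [norm_laurent h0, ho]
  simp

lemma one_le_norm_polyEmb {a : F[X]} (ha : a ≠ 0) : 1 ≤ ‖polyEmb a‖ := by
  rw [norm_polyEmb ha]
  exact one_le_pow₀ (one_lt_card_real F).le

lemma norm_le_of_coeff {x : F⸨X⸩} {n : ℤ} (h : ∀ k < n, x.coeff k = 0) :
    ‖x‖ ≤ (Nat.card F : ℝ) ^ (-n) := by
  by_cases hx : x = 0
  · simp only [hx, norm_zero]; positivity
  · rw [norm_laurent hx]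
    apply zpow_le_zpow_right₀ (one_lt_card_real F).le
    by_contra! hlt
    exact HahnSeries.coeff_order_eq_zero.not.mpr hx (h _ (by omega))

/-- Every Laurent series has a polynomial part. -/
lemma exists_polyPart (x : F⸨X⸩) : ∃ a : F[X], ‖x - polyEmb a‖ ≤ (Nat.card F : ℝ)⁻¹ := by
  obtain ⟨N, hN⟩ : ∃ N : ℕ, ∀ k : ℤ, k < -(N : ℤ) → x.coeff k = 0 :=
    ⟨(-x.order).toNat, fun k hk => HahnSeries.coeff_eq_zero_of_lt_order (by omega)⟩
  refine ⟨∑ i ∈ Finset.range (N + 1), Polynomial.monomial i (x.coeff (-(i : ℤ))), ?_⟩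
  rw [← zpow_neg_one]
  apply norm_le_of_coeff
  intro k hk
  obtain ⟨n, rfl⟩ : ∃ n : ℕ, k = -(n : ℤ) := ⟨(-k).toNat, by omega⟩
  rw [HahnSeries.coeff_sub, coeff_polyEmb, Polynomial.finsetSum_coeff]
  simp only [Polynomial.coeff_monomial, Finset.sum_ite_eq', Finset.mem_range]
  split_ifs with h
  · simp
  · rw [hN _ (by omega)]; simp

lemma norm_polyEmb_C {c : F} (hc : c ≠ 0) : ‖polyEmb (Polynomial.C c)‖ = 1 := by
  rw [norm_polyEmb (by simpa using hc)]; simp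

lemma norm_polyEmb_X_pow (n : ℕ) :
    ‖polyEmb ((Polynomial.X : F[X]) ^ n)‖ = (Nat.card F : ℝ) ^ n := by
  rw [norm_polyEmb (pow_ne_zero _ Polynomial.X_ne_zero)]; simp

/-- The absolute value of `F((T⁻¹))`, restricted to `F[T]`. -/
def polyAbs : AbsoluteValue F[X] ℝ where
  toFun a := ‖polyEmb a‖
  map_mul' := by simp
  nonneg' := by simp
  eq_zero' a := by
    rw [norm_eq_zero, map_eq_zero_iff _ polyEmb_injective]
  add_le' a b := by
    rw [map_add]
    exact norm_add_le _ _

lemma polyAbs_apply (a : F[X]) : polyAbs a = ‖polyEmb a‖ := rfl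

lemma norm_add_le_of_le' {E : Type*} [NormedField E] [IsUltrametricDist E] {x y : E} {r : ℝ}
    (hx : ‖x‖ ≤ r) (hy : ‖y‖ ≤ r) : ‖x + y‖ ≤ r :=
  (IsUltrametricDist.norm_add_le_max x y).trans (max_le hx hy)

/-! ### Heights -/

lemma norm_coeff_le_height (P : F[X][X]) (i : ℕ) : ‖polyEmb (P.coeff i)‖ ≤ height P := by
  by_cases h : i ∈ P.support
  · exact_mod_cast Finset.le_sup (f := fun i => ‖polyEmb (P.coeff i)‖₊) h
  · simp [Polynomial.notMem_support_iff.mp h]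

lemma height_le_iff {P : F[X][X]} {r : ℝ} (hr : 0 ≤ r) :
    (height P : ℝ) ≤ r ↔ ∀ i, ‖polyEmb (P.coeff i)‖ ≤ r := by
  refine ⟨fun h i => (norm_coeff_le_height P i).trans h, fun h => ?_⟩
  lift r to ℝ≥0 using hr
  rw [NNReal.coe_le_coe, height, Finset.sup_le_iff]
  exact fun i _ => by exact_mod_cast h i

/-- Gives access to Gauss's lemma: the height is multiplicative, so passing to a divisor does not
increase it. -/
lemma height_eq_gaussNorm (P : F[X][X]) : (height P : ℝ) = P.gaussNorm polyAbs 1 := by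
  apply le_antisymm
  · rw [height_le_iff (P.gaussNorm_nonneg _ zero_le_one)]
    intro i
    simpa [polyAbs_apply] using P.le_gaussNorm polyAbs (c := 1) zero_le_one i
  · obtain ⟨i, hi⟩ := P.exists_eq_gaussNorm polyAbs 1
    rw [hi]
    simpa [polyAbs_apply] using norm_coeff_le_height P i

lemma height_mul (P Q : F[X][X]) : (height (P * Q) : ℝ) = height P * height Q := by
  simp only [height_eq_gaussNorm]
  apply Polynomial.gaussNorm_mul _ one_pos
  intro a b
  rw [polyAbs_apply, map_add]
  exact IsUltrametricDist.norm_add_le_max _ _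

lemma one_le_height {P : F[X][X]} (hP : P ≠ 0) : 1 ≤ (height P : ℝ) :=
  (one_le_norm_polyEmb (Polynomial.leadingCoeff_ne_zero.mpr hP)).trans (norm_coeff_le_height P _)

lemma height_le_of_dvd {P Q : F[X][X]} (hP : P ≠ 0) (h : Q ∣ P) :
    (height Q : ℝ) ≤ height P := by
  obtain ⟨R, rfl⟩ := h
  rw [height_mul]
  exact le_mul_of_one_le_right (by positivity) (one_le_height (right_ne_zero_of_mul hP))

lemma exists_height_eq_pow {P : F[X][X]} (hP : P ≠ 0) :
    ∃ k : ℕ, (height P : ℝ) = (Nat.card F : ℝ) ^ k := by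
  obtain ⟨i, hi, h⟩ := Finset.exists_mem_eq_sup P.support (Polynomial.support_nonempty.mpr hP)
    fun i => ‖polyEmb (P.coeff i)‖₊
  refine ⟨(P.coeff i).natDegree, ?_⟩
  rw [← norm_polyEmb (Polynomial.mem_support_iff.mp hi), height, h]
  rfl

lemma height_C_C {c : F} (hc : c ≠ 0) : (height (Polynomial.C (Polynomial.C c)) : ℝ) = 1 := by
  apply le_antisymm
  · rw [height_le_iff zero_le_one]
    intro i
    rw [Polynomial.coeff_C]
    split_ifs
    · exact (norm_polyEmb_C hc).le
    · simp
  · exact one_le_height (by simpa using hc)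

lemma finite_natDegree_le (N : ℕ) : {a : F[X] | a.natDegree ≤ N}.Finite := by
  apply Set.Finite.of_injOn (f := fun a (i : Fin (N + 1)) => a.coeff i) (t := Set.univ)
    (fun _ _ => Set.mem_univ _) _ (Set.toFinite _)
  intro a ha b hb h
  ext n
  rcases le_or_gt n N with hn | hn
  · exact congrFun h ⟨n, by omega⟩
  · rw [Polynomial.coeff_eq_zero_of_natDegree_lt (lt_of_le_of_lt ha hn),
      Polynomial.coeff_eq_zero_of_natDegree_lt (lt_of_le_of_lt hb hn)]

lemma finite_norm_polyEmb_le (r : ℝ) : {a : F[X] | ‖polyEmb a‖ ≤ r}.Finite := by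
  obtain ⟨N, hN⟩ := pow_unbounded_of_one_lt r (one_lt_card_real F)
  apply (finite_natDegree_le (F := F) N).subset
  intro a ha
  rcases eq_or_ne a 0 with rfl | h0
  · simp
  · have h := (norm_polyEmb h0).symm.le.trans (show ‖polyEmb a‖ ≤ r from ha)
    exact ((pow_lt_pow_iff_right₀ (one_lt_card_real F)).mp (h.trans_lt hN)).le

/-- This finiteness makes the infima in both exponents minima. -/
lemma finite_height_le (n : ℕ) (H : ℝ≥0) :
    {P : F[X][X] | height P ≤ H ∧ P.natDegree ≤ n}.Finite := by
  apply Set.Finite.of_injOn (f := fun P (i : Fin (n + 1)) => P.coeff i)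
    (t := Set.univ.pi fun _ => {a : F[X] | ‖polyEmb a‖ ≤ H}) _ _
    (Set.Finite.pi fun _ => finite_norm_polyEmb_le _)
  · intro P hP i _
    exact (norm_coeff_le_height P i).trans (by exact_mod_cast hP.1)
  · intro P hP Q hQ h
    ext1 k
    rcases le_or_gt k n with hk | hk
    · exact congrFun h ⟨k, by omega⟩
    · rw [Polynomial.coeff_eq_zero_of_natDegree_lt (lt_of_le_of_lt hP.2 hk),
        Polynomial.coeff_eq_zero_of_natDegree_lt (lt_of_le_of_lt hQ.2 hk)]

/-! ### Minimal polynomials over F[T] -/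

/-- The embedding of `F[T]` into the algebraic closure of `F((T⁻¹))`. -/
abbrev closureEmb : F[X] →+* AlgebraicClosure F⸨X⸩ :=
  (algebraMap F⸨X⸩ (AlgebraicClosure F⸨X⸩)).comp polyEmb

lemma closureEmb_injective : Function.Injective (closureEmb (F := F)) :=
  (algebraMap F⸨X⸩ (AlgebraicClosure F⸨X⸩)).injective.comp polyEmb_injective

lemma exists_irreducible_dvd_of_root {P : F[X][X]} (hP : P ≠ 0) {α : AlgebraicClosure F⸨X⸩}
    (h : P.eval₂ closureEmb α = 0) :
    ∃ Q, Irreducible Q ∧ Q ∣ P ∧ Q.eval₂ closureEmb α = 0 := by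
  induction P using WfDvdMonoid.induction_on_irreducible with
  | zero => exact absurd rfl hP
  | unit u hu =>
    have := (hu.map (Polynomial.eval₂RingHom closureEmb α)).ne_zero
    exact absurd h this
  | mul a i ha hi ih =>
    rw [Polynomial.eval₂_mul, mul_eq_zero] at h
    rcases h with h | h
    · exact ⟨i, hi, dvd_mul_right _ _, h⟩
    · obtain ⟨Q, h1, h2, h3⟩ := ih ha h
      exact ⟨Q, h1, h2.mul_left _, h3⟩

/-- A root of a nonzero polynomial over `F[T]` has a minimal polynomial, which divides it. -/
lemma exists_isMinPoly {P : F[X][X]} (hP : P ≠ 0) {α : AlgebraicClosure F⸨X⸩}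
    (h : P.eval₂ closureEmb α = 0) : ∃ Q, IsMinPoly Q α ∧ Q ∣ P := by
  obtain ⟨Q, hQ, hd, h0⟩ := exists_irreducible_dvd_of_root hP h
  have hdeg : 0 < Q.natDegree := by
    by_contra! hle
    obtain ⟨c, rfl⟩ := Polynomial.natDegree_eq_zero.mp (Nat.le_zero.mp hle)
    rw [Polynomial.eval₂_C, map_eq_zero_iff _ closureEmb_injective] at h0
    exact hQ.ne_zero (by simp [h0])
  have hl : Q.leadingCoeff.leadingCoeff ≠ 0 := by simpa using hQ.ne_zero
  have hu : IsUnit (Polynomial.C (Polynomial.C Q.leadingCoeff.leadingCoeff⁻¹)) :=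
    ((IsUnit.mk0 _ (inv_ne_zero hl)).map Polynomial.C).map Polynomial.C
  have hirr : Irreducible (Polynomial.C (Polynomial.C Q.leadingCoeff.leadingCoeff⁻¹) * Q) :=
    (irreducible_isUnit_mul hu).mpr hQ
  have hdeg' : (Polynomial.C (Polynomial.C Q.leadingCoeff.leadingCoeff⁻¹) * Q).natDegree
      = Q.natDegree := by
    rw [Polynomial.natDegree_C_mul]
    simpa using hQ.ne_zero
  refine ⟨_, ⟨by omega, hirr, hirr.isPrimitive (by omega), ?_, ?_⟩,
    (hu.mul_left_dvd).mpr hd⟩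
  · rw [Polynomial.leadingCoeff_mul, Polynomial.leadingCoeff_C, Polynomial.Monic,
      Polynomial.leadingCoeff_mul, Polynomial.leadingCoeff_C, inv_mul_cancel₀ hl]
  · rw [Polynomial.eval₂_mul]
    exact mul_eq_zero_of_right _ h0

lemma exists_isMinPoly_height_le {P : F[X][X]} (hP : P ≠ 0) {α : AlgebraicClosure F⸨X⸩}
    (h : P.eval₂ closureEmb α = 0) :
    ∃ Q, IsMinPoly Q α ∧ height Q ≤ height P ∧ Q.natDegree ≤ P.natDegree := by
  obtain ⟨Q, hQ, hd⟩ := exists_isMinPoly hP h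
  exact ⟨Q, hQ, height_le_of_dvd hP hd, Polynomial.natDegree_le_of_dvd hd hP⟩

/-- The embedding of `F((T⁻¹))` into its algebraic closure. -/
abbrev toClosure : F⸨X⸩ →+* AlgebraicClosure F⸨X⸩ :=
  algebraMap F⸨X⸩ (AlgebraicClosure F⸨X⸩)

lemma eval₂_closureEmb (P : F[X][X]) (ξ : F⸨X⸩) :
    P.eval₂ closureEmb (toClosure ξ) = toClosure (P.eval₂ polyEmb ξ) := by
  rw [Polynomial.hom_eval₂]

/-! ### The two minima are attained and positive -/

lemma minPolyValue_le {n : ℕ} {ξ : F⸨X⸩} {H : ℕ} {P : F[X][X]} (hH : (height P : ℝ) ≤ H)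
    (hn : P.natDegree ≤ n) (h0 : P.eval₂ polyEmb ξ ≠ 0) :
    minPolyValue n ξ H ≤ ‖P.eval₂ polyEmb ξ‖ :=
  csInf_le ⟨0, by rintro _ ⟨P, -, -, -, rfl⟩; exact norm_nonneg _⟩
    ⟨P, by exact_mod_cast hH, hn, h0, rfl⟩

lemma exists_minPolyValue (n : ℕ) (ξ : F⸨X⸩) {H : ℕ} (hH : 1 ≤ H) :
    ∃ P : F[X][X], (height P : ℝ) ≤ H ∧ P.natDegree ≤ n ∧ P.eval₂ polyEmb ξ ≠ 0 ∧
      minPolyValue n ξ H = ‖P.eval₂ polyEmb ξ‖ := by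
  set s := {r : ℝ | ∃ P : F[X][X], height P ≤ H ∧ P.natDegree ≤ n ∧
    P.eval₂ polyEmb ξ ≠ 0 ∧ r = ‖P.eval₂ polyEmb ξ‖}
  have hfin : s.Finite := by
    apply ((finite_height_le (F := F) n H).image fun P => ‖P.eval₂ polyEmb ξ‖).subset
    rintro _ ⟨P, h1, h2, -, rfl⟩
    exact ⟨P, ⟨h1, h2⟩, rfl⟩
  have hne : s.Nonempty := by
    refine ⟨1, 1, ?_, by simp, by simp, by simp⟩
    have h := height_C_C (F := F) one_ne_zero
    rw [map_one, map_one, NNReal.coe_eq_one] at h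
    rw [h]
    exact_mod_cast hH
  obtain ⟨P, h1, h2, h3, h4⟩ := hne.csInf_mem hfin
  exact ⟨P, by exact_mod_cast h1, h2, h3, h4⟩

lemma minPolyValue_pos (n : ℕ) (ξ : F⸨X⸩) {H : ℕ} (hH : 1 ≤ H) : 0 < minPolyValue n ξ H := by
  obtain ⟨P, -, -, h, h'⟩ := exists_minPolyValue n ξ hH
  rw [h']
  exact norm_pos_iff.mpr h

lemma minPolyValue_le_one (n : ℕ) (ξ : F⸨X⸩) {H : ℕ} (hH : 1 ≤ H) : minPolyValue n ξ H ≤ 1 := by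
  have h := height_C_C (F := F) one_ne_zero
  rw [map_one, map_one] at h
  simpa using minPolyValue_le (n := n) (ξ := ξ) (P := 1) (H := H)
    (by rw [h]; exact_mod_cast hH) (by simp) (by simp)

/-- Any polynomial vanishing at α will do, reducible or not: its factor that is minimal for α has no
larger height or degree. -/
lemma minAlgDist_le {n : ℕ} {ξ : F⸨X⸩} {H : ℕ} {P : F[X][X]} {α : AlgebraicClosure F⸨X⸩}
    (hP : P ≠ 0) (hα : P.eval₂ closureEmb α = 0) (hH : (height P : ℝ) ≤ H)
    (hn : P.natDegree ≤ n) (h0 : α ≠ toClosure ξ) :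
    minAlgDist n ξ H ≤ ‖toClosure ξ - α‖ := by
  obtain ⟨Q, h1, h2, h3⟩ := exists_isMinPoly_height_le hP hα
  exact csInf_le ⟨0, by rintro _ ⟨α, -, -, rfl⟩; exact norm_nonneg (toClosure ξ - α)⟩
    ⟨α, ⟨Q, h1, h2.trans (by exact_mod_cast hH), h3.trans hn⟩, h0, rfl⟩

lemma height_X_sub_C_le {c : F} :
    (height (Polynomial.X - Polynomial.C (Polynomial.C c)) : ℝ) ≤ 1 := by
  rw [height_le_iff zero_le_one]
  intro i
  have h1 : ‖polyEmb ((Polynomial.X : F[X][X]).coeff i)‖ ≤ 1 := by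
    rw [Polynomial.coeff_X]; split_ifs <;> simp
  have h2 : ‖-polyEmb ((Polynomial.C (Polynomial.C c) : F[X][X]).coeff i)‖ ≤ 1 := by
    rw [Polynomial.coeff_C, norm_neg]
    split_ifs
    · rcases eq_or_ne c 0 with rfl | hc
      · simp
      · exact (norm_polyEmb_C hc).le
    · simp
  rw [Polynomial.coeff_sub, map_sub, sub_eq_add_neg]
  exact norm_add_le_of_le' h1 h2

lemma exists_minAlgDist {n : ℕ} (hn : 1 ≤ n) (ξ : F⸨X⸩) {H : ℕ} (hH : 1 ≤ H) :
    ∃ (P : F[X][X]) (α : AlgebraicClosure F⸨X⸩), P ≠ 0 ∧ P.eval₂ closureEmb α = 0 ∧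
      (height P : ℝ) ≤ H ∧ P.natDegree ≤ n ∧ α ≠ toClosure ξ ∧
      minAlgDist n ξ H = ‖toClosure ξ - α‖ := by
  set s := {r : ℝ | ∃ α : AlgebraicClosure F⸨X⸩,
    (∃ P : F[X][X], IsMinPoly P α ∧ height P ≤ H ∧ P.natDegree ≤ n) ∧
    α ≠ algebraMap F⸨X⸩ (AlgebraicClosure F⸨X⸩) ξ ∧
    r = absClosure (algebraMap F⸨X⸩ (AlgebraicClosure F⸨X⸩) ξ - α)}
  have hfin : s.Finite := by
    apply ((finite_height_le (F := F) n H).biUnion fun P _ =>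
      ((P.map closureEmb).rootSet_finite (AlgebraicClosure F⸨X⸩)).image
        fun α => ‖toClosure ξ - α‖).subset
    rintro _ ⟨α, ⟨P, ⟨h0, h1, h2, h3, h4⟩, h5, h6⟩, -, rfl⟩
    refine Set.mem_biUnion (x := P) ⟨h5, h6⟩ ⟨α, ?_, rfl⟩
    rw [Polynomial.mem_rootSet]
    refine ⟨(Polynomial.map_ne_zero_iff closureEmb_injective).mpr h1.ne_zero, ?_⟩
    rw [Polynomial.aeval_def, Algebra.algebraMap_self, Polynomial.eval₂_id, Polynomial.eval_map]
    exact h4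
  have hne : s.Nonempty := by
    have key : ∀ c : F, closureEmb (Polynomial.C c) ≠ toClosure ξ → s.Nonempty := by
      intro c hc
      obtain ⟨Q, h1, h2, h3⟩ := exists_isMinPoly_height_le
        (P := Polynomial.X - Polynomial.C (Polynomial.C c)) (Polynomial.X_sub_C_ne_zero _)
        (α := closureEmb (Polynomial.C c)) (by simp)
      rw [Polynomial.natDegree_X_sub_C] at h3
      have h4 : (height Q : ℝ) ≤ H := by
        refine le_trans ?_ (height_X_sub_C_le (c := c) |>.trans (by exact_mod_cast hH))
        exact_mod_cast h2
      exact ⟨_, _, ⟨Q, h1, by exact_mod_cast h4, h3.trans hn⟩, hc, rfl⟩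
    -- At least one of the constants 0 and 1 differs from ξ.
    by_cases h : closureEmb (Polynomial.C 0) = toClosure ξ
    · apply key 1
      rw [← h, Polynomial.C_0, Polynomial.C_1, map_zero, map_one]
      exact one_ne_zero
    · exact key 0 h
  obtain ⟨α, ⟨P, h1, h2, h3⟩, h4, h5⟩ := hne.csInf_mem hfin
  exact ⟨P, α, h1.2.1.ne_zero, h1.2.2.2.2, by exact_mod_cast h2, h3, h4, h5⟩

lemma minAlgDist_pos {n : ℕ} (hn : 1 ≤ n) (ξ : F⸨X⸩) {H : ℕ} (hH : 1 ≤ H) :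
    0 < minAlgDist n ξ H := by
  obtain ⟨P, α, -, -, -, -, h, h'⟩ := exists_minAlgDist hn ξ hH
  rw [h', norm_pos_iff, sub_ne_zero]
  exact h.symm

/-! ### Estimating limits superior -/

/-- Terms `c / log H` do not matter for an upper bound of a `limsup`. -/
lemma limsup_le_of_le_add_div_log {u : ℕ → ℝ} {a : EReal} {v : ℕ → ℝ} (c : ℝ)
    (huv : ∀ᶠ H : ℕ in Filter.atTop, u H ≤ v H + c / Real.log H)
    (hv : Filter.limsup (fun H => (v H : EReal)) Filter.atTop ≤ a) :
    Filter.limsup (fun H => (u H : EReal)) Filter.atTop ≤ a := by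
  apply le_of_forall_gt
  intro b hb
  obtain ⟨r, har, hrb⟩ := EReal.lt_iff_exists_real_btwn.mp hb
  obtain ⟨s, has, hsr⟩ := EReal.lt_iff_exists_real_btwn.mp har
  refine lt_of_le_of_lt ?_ hrb
  have h1 := Filter.eventually_lt_of_limsup_lt (hv.trans_lt has)
  have h2 : Filter.Tendsto (fun H : ℕ => c / Real.log H) Filter.atTop (nhds 0) :=
    Filter.Tendsto.const_div_atTop (Real.tendsto_log_atTop.comp tendsto_natCast_atTop_atTop) c
  have h3 := h2.eventually_lt_const (sub_pos.mpr (EReal.coe_lt_coe_iff.mp hsr))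
  apply Filter.limsup_le_of_le
  · isBoundedDefault
  filter_upwards [huv, h1, h3] with H g1 g2 g3
  rw [EReal.coe_lt_coe_iff] at g2
  rw [EReal.coe_le_coe_iff]
  linarith

lemma limsup_const_le {u : ℕ → ℝ} (w c : ℝ)
    (hu : ∀ᶠ H : ℕ in Filter.atTop, u H ≤ w + c / Real.log H) :
    Filter.limsup (fun H => (u H : EReal)) Filter.atTop ≤ (w : EReal) :=
  limsup_le_of_le_add_div_log (v := fun _ => w) c hu (by simp)

/-- A lower bound of a `limsup` along a subsequence `f`. -/
lemma le_limsup_of_subseq {u : ℕ → ℝ} (w : ℝ) {f : ℕ → ℕ}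
    (hf : Filter.Tendsto f Filter.atTop Filter.atTop)
    (c : ℝ) (hu : ∀ᶠ j in Filter.atTop, w - c / Real.log (f j) ≤ u (f j)) :
    (w : EReal) ≤ Filter.limsup (fun H => (u H : EReal)) Filter.atTop := by
  apply le_of_forall_lt
  intro b hb
  obtain ⟨r, hbr, hrw⟩ := EReal.lt_iff_exists_real_btwn.mp hb
  refine hbr.trans_le ?_
  have h2 : Filter.Tendsto (fun j : ℕ => c / Real.log (f j)) Filter.atTop (nhds 0) :=
    Filter.Tendsto.const_div_atTop (Real.tendsto_log_atTop.comp
      (tendsto_natCast_atTop_atTop.comp hf)) c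
  have h3 := h2.eventually_lt_const (sub_pos.mpr (EReal.coe_lt_coe_iff.mp hrw))
  apply Filter.le_limsup_of_frequently_le
  · apply hf.frequently
    apply Filter.Eventually.frequently
    filter_upwards [h3, hu] with j g1 g2
    rw [EReal.coe_le_coe_iff]
    linarith
  · isBoundedDefault

/-! ### The inequality w₂* ≤ w₂ -/

lemma eval₂_of_natDegree_le_two {R S : Type*} [CommRing R] [CommRing S] (f : R →+* S) (x : S)
    {P : R[X]}
    (hP : P.natDegree ≤ 2) :
    P.eval₂ f x = f (P.coeff 2) * x ^ 2 + f (P.coeff 1) * x + f (P.coeff 0) := by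
  rw [Polynomial.eval₂_eq_sum_range' f (Nat.lt_succ_of_le hP)]
  simp [Finset.sum_range_succ]
  ring

lemma norm_closureEmb (a : F[X]) : ‖closureEmb a‖ = ‖polyEmb a‖ := norm_algebraMap_closure _

/-- Distinct roots of a quadratic polynomial are far apart, as its discriminant is in `F[T]`. -/
lemma one_le_norm_mul_sub_of_roots {P : F[X][X]} (hP : P ≠ 0) (hn : P.natDegree ≤ 2)
    {α β : AlgebraicClosure F⸨X⸩} (hα : P.eval₂ closureEmb α = 0) (hβ : P.eval₂ closureEmb β = 0)
    (hαβ : α ≠ β) : 1 ≤ ‖polyEmb (P.coeff 2)‖ * ‖α - β‖ := by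
  rw [eval₂_of_natDegree_le_two _ _ hn] at hα hβ
  set a := P.coeff 2 with ha
  set b := P.coeff 1 with hb
  set c := P.coeff 0 with hc
  -- Vieta's formulas, obtained by subtracting the two equations and cancelling α - β; this also
  -- works if a = 0, which is then excluded because P would vanish.
  have hs : closureEmb b = -(closureEmb a * (α + β)) := by
    apply mul_left_cancel₀ (sub_ne_zero.mpr hαβ)
    linear_combination hα - hβ
  have hp : closureEmb c = closureEmb a * (α * β) := by
    linear_combination hα - α * hs
  have ha0 : a ≠ 0 := by
    intro h0
    rw [h0, map_zero, zero_mul] at hs hp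
    rw [neg_zero, map_eq_zero_iff _ closureEmb_injective] at hs
    rw [map_eq_zero_iff _ closureEmb_injective] at hp
    apply hP
    ext1 i
    rcases i with _ | _ | _ | i
    · exact hp
    · exact hs
    · exact h0
    · exact Polynomial.coeff_eq_zero_of_natDegree_lt (by omega)
  have hd : (closureEmb a * (α - β)) ^ 2 = closureEmb (b ^ 2 - 4 * a * c) := by
    simp only [map_sub, map_mul, map_pow, hs, hp, map_ofNat]
    ring
  have hd0 : b ^ 2 - 4 * a * c ≠ 0 := by
    intro h0
    rw [h0, map_zero, pow_eq_zero_iff two_ne_zero, mul_eq_zero,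
      map_eq_zero_iff _ closureEmb_injective] at hd
    exact hd.elim ha0 (sub_ne_zero.mpr hαβ)
  have h1 : 1 ≤ ‖closureEmb a * (α - β)‖ ^ 2 := by
    rw [← norm_pow, hd, norm_closureEmb]
    exact one_le_norm_polyEmb hd0
  rw [← norm_closureEmb, ← norm_mul]
  exact (one_le_sq_iff₀ (norm_nonneg _)).mp h1

/-- The difference factors as (a(ξ + α) + b)(ξ - α), and the ultrametric inequality bounds the first
factor. -/
lemma norm_eval₂_le {P : F[X][X]} (hn : P.natDegree ≤ 2) {ξ α : AlgebraicClosure F⸨X⸩} {M : ℝ}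
    (hM : 1 ≤ M) (hξ : ‖ξ‖ ≤ M) (hα : ‖α‖ ≤ M) :
    ‖P.eval₂ closureEmb ξ - P.eval₂ closureEmb α‖ ≤ height P * M * ‖ξ - α‖ := by
  rw [eval₂_of_natDegree_le_two _ _ hn, eval₂_of_natDegree_le_two _ _ hn]
  have : ∀ a b c : AlgebraicClosure F⸨X⸩, a * ξ ^ 2 + b * ξ + c - (a * α ^ 2 + b * α + c)
      = (a * (ξ + α) + b) * (ξ - α) := by intros; ring
  rw [this, norm_mul]
  gcongr
  apply norm_add_le_of_le'
  · rw [norm_mul, norm_closureEmb]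
    exact mul_le_mul (norm_coeff_le_height P 2) (norm_add_le_of_le' hξ hα) (norm_nonneg _) (by simp)
  · rw [norm_closureEmb]
    exact (norm_coeff_le_height P 1).trans (le_mul_of_one_le_right (by simp) hM)

/-- Comparison of the two minima. -/
lemma minPolyValue_le_mul_minAlgDist (ξ : F⸨X⸩) {H : ℕ} (hH : 1 ≤ H) :
    minPolyValue 2 ξ H ≤ max 1 ‖ξ‖ * (H * minAlgDist 2 ξ H) := by
  obtain ⟨P, α, hP, hα, hh, hn, hne, hk⟩ := exists_minAlgDist (n := 2) (by norm_num) ξ hH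
  have hM : 1 ≤ max 1 ‖ξ‖ := le_max_left _ _
  have hH' : (1 : ℝ) ≤ H := by exact_mod_cast hH
  have h1 := minPolyValue_le_one 2 ξ hH
  rw [hk]
  -- If ξ is itself a root, P is not admissible for the polynomial minimum. But then ξ and α are
  -- distinct roots of P, so H|ξ - α| ≥ 1, and the trivial bound 1 for that minimum suffices.
  by_cases h0 : P.eval₂ polyEmb ξ = 0
  · refine h1.trans (one_le_mul_of_one_le_of_one_le hM ?_)
    have h0' : P.eval₂ closureEmb (toClosure ξ) = 0 := by rw [eval₂_closureEmb, h0, map_zero]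
    refine (one_le_norm_mul_sub_of_roots hP hn h0' hα hne.symm).trans ?_
    gcongr
    exact (norm_coeff_le_height P 2).trans hh
  · rcases le_or_gt ‖toClosure ξ - α‖ 1 with h | h
    · refine (minPolyValue_le hh hn h0).trans ?_
      have hξ : ‖toClosure ξ‖ ≤ max 1 ‖ξ‖ := by
        rw [norm_algebraMap_closure]; exact le_max_right _ _
      have hα' : ‖α‖ ≤ max 1 ‖ξ‖ := by
        have : α = toClosure ξ + -(toClosure ξ - α) := by ring
        rw [this]
        exact norm_add_le_of_le' hξ (by rw [norm_neg]; exact h.trans hM)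
      have := norm_eval₂_le hn hM hξ hα'
      rw [hα, sub_zero, eval₂_closureEmb, norm_algebraMap_closure] at this
      refine this.trans ?_
      rw [mul_comm (height P : ℝ), mul_assoc]
      gcongr
    · exact h1.trans (one_le_mul_of_one_le_of_one_le hM (one_le_mul_of_one_le_of_one_le hH' h.le))

theorem koksmaExp_le_mahlerExp (ξ : F⸨X⸩) : koksmaExp 2 ξ ≤ mahlerExp 2 ξ := by
  refine limsup_le_of_le_add_div_log (Real.log (max 1 ‖ξ‖)) ?_ le_rfl
  filter_upwards [Filter.eventually_ge_atTop 2] with H hH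
  rw [← add_div]
  have hlog : 0 < Real.log H := Real.log_pos (by exact_mod_cast hH)
  gcongr
  have hM : 0 < max 1 ‖ξ‖ := lt_max_of_lt_left one_pos
  have hk : 0 < H * minAlgDist 2 ξ H :=
    mul_pos (by exact_mod_cast (by omega : 0 < H)) (minAlgDist_pos (by norm_num) ξ (by omega))
  have h := Real.log_le_log (minPolyValue_pos 2 ξ (by omega))
    (minPolyValue_le_mul_minAlgDist ξ (by omega : 1 ≤ H))
  rw [Real.log_mul hM.ne' hk.ne'] at h
  linarith

/-! ### Nonnegativity of the exponents -/

/-- The exponents are nonnegative, by truncation of the series. -/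
theorem koksmaExp_nonneg (ξ : F⸨X⸩) : 0 ≤ koksmaExp 2 ξ := by
  set q : ℝ := (Nat.card F : ℝ) with hq
  have hq1 : 1 < q := one_lt_card_real F
  -- The shift s allows for |ξ| > 1: the numerator of a truncation A / T^m can have size up to q^(m
  -- + s).
  obtain ⟨s, hs⟩ := pow_unbounded_of_one_lt ‖ξ‖ hq1
  have key : ∀ m : ℕ, ((Nat.card F ^ (m + s) : ℕ) : ℝ) *
      minAlgDist 2 ξ (Nat.card F ^ (m + s)) ≤ q ^ s := by
    intro m
    set t := polyEmb ((Polynomial.X : F[X]) ^ m) with ht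
    have htn : ‖t‖ = q ^ m := norm_polyEmb_X_pow m
    have ht0 : t ≠ 0 := by rw [← norm_pos_iff, htn]; positivity
    obtain ⟨A, hA1, hA2⟩ : ∃ A : F[X], ‖t * ξ - polyEmb A‖ ≤ 1 ∧ polyEmb A / t ≠ ξ := by
      obtain ⟨A, hA⟩ := exists_polyPart (t * ξ)
      have hA' : ‖t * ξ - polyEmb A‖ ≤ 1 := hA.trans (inv_le_one_of_one_le₀ hq1.le)
      -- The approximation must differ from ξ; if truncation is exact, adding 1 to the numerator
      -- costs only a distance q^(-m).
      by_cases h : polyEmb A / t = ξ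
      · refine ⟨A + 1, ?_, ?_⟩
        · rw [map_add, map_one, ← h, mul_div_cancel₀ _ ht0]
          simp
        · rw [map_add, map_one, add_div, h]
          simpa using ht0
      · exact ⟨A, hA', h⟩
    have hAn : ‖polyEmb A‖ ≤ q ^ (m + s) := by
      have : polyEmb A = t * ξ + -(t * ξ - polyEmb A) := by ring
      rw [this]
      apply norm_add_le_of_le'
      · rw [norm_mul, htn, pow_add]; gcongr
      · rw [norm_neg]; exact hA1.trans (one_le_pow₀ hq1.le)
    set P : F[X][X] := Polynomial.C (Polynomial.X ^ m) * Polynomial.X - Polynomial.C A with hP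
    have hc : ∀ i, P.coeff i = if i = 0 then -A else if i = 1 then Polynomial.X ^ m else 0 := by
      intro i
      rw [hP, Polynomial.coeff_sub, Polynomial.coeff_C_mul, Polynomial.coeff_X, Polynomial.coeff_C]
      rcases i with _ | _ | i <;> simp
    have hP0 : P ≠ 0 := by
      intro h
      have := hc 1
      rw [h, if_neg one_ne_zero, if_pos rfl] at this
      exact pow_ne_zero m Polynomial.X_ne_zero this.symm
    have hroot : P.eval₂ closureEmb (toClosure (polyEmb A / t)) = 0 := by
      rw [eval₂_closureEmb]
      simp only [hP, Polynomial.eval₂_sub, Polynomial.eval₂_mul, Polynomial.eval₂_C,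
        Polynomial.eval₂_X]
      rw [← ht, mul_div_cancel₀ _ ht0, sub_self, map_zero]
    have hh : (height P : ℝ) ≤ ((Nat.card F ^ (m + s) : ℕ) : ℝ) := by
      push_cast
      rw [← hq, height_le_iff (by positivity)]
      intro i
      rw [hc]
      split_ifs
      · rwa [map_neg, norm_neg]
      · rw [norm_polyEmb_X_pow]
        exact pow_le_pow_right₀ hq1.le (by omega)
      · rw [map_zero, norm_zero]; positivity
    have hdeg : P.natDegree ≤ 2 := by
      rw [Polynomial.natDegree_le_iff_coeff_eq_zero]
      intro N hN
      rw [hc, if_neg (by omega), if_neg (by omega)]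
    have h := minAlgDist_le hP0 hroot hh hdeg fun h => hA2 (toClosure.injective h)
    rw [← map_sub, norm_algebraMap_closure] at h
    have h2 : ‖ξ - polyEmb A / t‖ ≤ (q ^ m)⁻¹ := by
      have : ξ - polyEmb A / t = (t * ξ - polyEmb A) / t := by field_simp
      rw [this, norm_div, htn, div_eq_mul_inv]
      exact mul_le_of_le_one_left (by positivity) hA1
    calc _ ≤ ((Nat.card F ^ (m + s) : ℕ) : ℝ) * (q ^ m)⁻¹ := by gcongr; exact h.trans h2
      _ = q ^ s := by
        push_cast; rw [← hq, pow_add]; field_simp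
  refine le_limsup_of_subseq (f := fun m => Nat.card F ^ (m + s)) 0 ?_ (Real.log (q ^ s)) ?_
  · exact (tendsto_pow_atTop_atTop_of_one_lt Finite.one_lt_card).comp
      (Filter.tendsto_add_atTop_nat s)
  · filter_upwards [Filter.eventually_ge_atTop 1] with m hm
    have hpos : 0 < ((Nat.card F ^ (m + s) : ℕ) : ℝ) * minAlgDist 2 ξ (Nat.card F ^ (m + s)) := by
      have : 0 < Nat.card F ^ (m + s) := pow_pos Nat.card_pos _
      exact mul_pos (by exact_mod_cast this) (minAlgDist_pos (by norm_num) _ this)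
    have h := Real.log_le_log hpos (key m)
    rw [zero_sub, ← neg_div]
    gcongr

/-! ### The inequality w₂ ≤ w₂* + 1 -/

/-- Unless it has a double root, a polynomial of degree at most two has a root whose distance to `ξ`
is at most the value at `ξ`. -/
lemma exists_root_norm_sub_le {P : F[X][X]} (hn : P.natDegree ≤ 2) {ξ : F⸨X⸩}
    (h1 : ‖P.eval₂ polyEmb ξ‖ < 1) (h0 : P.eval₂ polyEmb ξ ≠ 0)
    (hd : P.natDegree ≤ 1 ∨ P.coeff 1 ^ 2 ≠ 4 * P.coeff 2 * P.coeff 0) :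
    ∃ α, P.eval₂ closureEmb α = 0 ∧ ‖toClosure ξ - α‖ ≤ ‖P.eval₂ polyEmb ξ‖ := by
  have hP : P ≠ 0 := by rintro rfl; simp at h0
  have hev := eval₂_of_natDegree_le_two closureEmb (toClosure ξ) hn
  rw [eval₂_closureEmb] at hev
  rw [← norm_algebraMap_closure, ← toClosure] at h1 ⊢
  rcases eq_or_ne (P.coeff 2) 0 with ha | ha
  · rcases eq_or_ne (P.coeff 1) 0 with hb | hb
    · exfalso
      rw [hev, ha, hb, map_zero, zero_mul, zero_mul, zero_add, zero_add, norm_closureEmb] at h1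
      refine absurd (one_le_norm_polyEmb ?_) h1.not_ge
      rintro hc
      rw [ha, hb, hc] at hev
      simp at hev
      exact h0 hev
    · have hb' : closureEmb (P.coeff 1) ≠ 0 := (map_ne_zero_iff _ closureEmb_injective).mpr hb
      refine ⟨-closureEmb (P.coeff 0) / closureEmb (P.coeff 1), ?_, ?_⟩
      · rw [eval₂_of_natDegree_le_two _ _ hn, ha]
        field_simp
        simp
      · have : toClosure (P.eval₂ polyEmb ξ) = closureEmb (P.coeff 1) *
            (toClosure ξ - -closureEmb (P.coeff 0) / closureEmb (P.coeff 1)) := by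
          rw [hev, ha]
          field_simp
          simp
        rw [this, norm_mul, norm_closureEmb]
        exact le_mul_of_one_le_left (norm_nonneg _) (one_le_norm_polyEmb hb)
  · have ha' : closureEmb (P.coeff 2) ≠ 0 := (map_ne_zero_iff _ closureEmb_injective).mpr ha
    have hdeg : P.natDegree = 2 := le_antisymm hn (Polynomial.le_natDegree_of_ne_zero ha)
    replace hd := hd.resolve_left (by omega)
    obtain ⟨α, hα⟩ := IsAlgClosed.exists_eval₂_eq_zero_of_injective closureEmb closureEmb_injective P
      (by rw [Polynomial.degree_eq_natDegree hP, hdeg]; norm_num)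
    set β := -closureEmb (P.coeff 1) / closureEmb (P.coeff 2) - α with hβdef
    have hs : closureEmb (P.coeff 1) = -(closureEmb (P.coeff 2) * (α + β)) := by
      rw [hβdef]; field_simp; ring
    have hp : closureEmb (P.coeff 0) = closureEmb (P.coeff 2) * (α * β) := by
      have h := hα
      rw [eval₂_of_natDegree_le_two _ _ hn] at h
      linear_combination h - α * hs
    have hβ : P.eval₂ closureEmb β = 0 := by
      rw [eval₂_of_natDegree_le_two _ _ hn, hs, hp]; ring
    have hαβ : α ≠ β := by
      intro h
      apply hd
      apply closureEmb_injective
      simp only [map_mul, map_pow, map_ofNat]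
      rw [hs, hp, h]; ring
    have hev' : toClosure (P.eval₂ polyEmb ξ)
        = closureEmb (P.coeff 2) * ((toClosure ξ - α) * (toClosure ξ - β)) := by
      rw [hev, hs, hp]; ring
    -- If x is the root nearer to ξ, then |ξ - y| ≥ |x - y|, so |a||ξ - y| ≥ 1 and |a||ξ - x||ξ - y|
    -- ≥ |ξ - x|.
    have key : ∀ x y : AlgebraicClosure F⸨X⸩, 1 ≤ ‖closureEmb (P.coeff 2)‖ * ‖x - y‖ →
        ‖toClosure ξ - x‖ ≤ ‖toClosure ξ - y‖ → ‖toClosure ξ - x‖ ≤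
          ‖closureEmb (P.coeff 2) * ((toClosure ξ - x) * (toClosure ξ - y))‖ := by
      intro x y hxy hle
      have h2 : ‖x - y‖ ≤ ‖toClosure ξ - y‖ := by
        have : x - y = (toClosure ξ - y) + -(toClosure ξ - x) := by ring
        rw [this]
        exact norm_add_le_of_le' le_rfl (by rwa [norm_neg])
      rw [norm_mul, norm_mul, mul_left_comm]
      refine le_mul_of_one_le_right (norm_nonneg _) (hxy.trans ?_)
      gcongr
    have hdist := one_le_norm_mul_sub_of_roots hP hn hα hβ hαβ
    rw [← norm_closureEmb] at hdist
    rw [hev']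
    rcases le_total ‖toClosure ξ - α‖ ‖toClosure ξ - β‖ with h | h
    · exact ⟨α, hα, key α β hdist h⟩
    · refine ⟨β, hβ, ?_⟩
      rw [mul_comm (toClosure ξ - α)]
      exact key β α (by rwa [norm_sub_rev]) h

/-- Outside characteristic two, a polynomial with zero discriminant is a constant multiple of a
square. -/
lemma exists_sq_dvd {P : F[X][X]} (h2 : (2 : F) ≠ 0) (hn : P.natDegree = 2)
    (hd : P.coeff 1 ^ 2 = 4 * P.coeff 2 * P.coeff 0) :
    ∃ (Q : F[X][X]) (g : F[X]), Q.natDegree ≤ 1 ∧ P = Q ^ 2 * Polynomial.C g := by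
  have hP : P ≠ 0 := by rintro rfl; simp at hn
  have ha : P.coeff 2 ≠ 0 := by
    rw [← hn]; exact Polynomial.leadingCoeff_ne_zero.mpr hP
  have h2' : (2 : F[X]) ≠ 0 := by
    rw [← Polynomial.C_ofNat]
    simpa using h2
  -- S is the derivative of P; zero discriminant means S² = 4aP.
  set S : F[X][X] := Polynomial.C (2 * P.coeff 2) * Polynomial.X + Polynomial.C (P.coeff 1) with hS
  have hSdeg : S.natDegree = 1 := Polynomial.natDegree_linear (mul_ne_zero h2' ha)
  have hSP : S ^ 2 = Polynomial.C (4 * P.coeff 2) * P := by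
    have hPe : P = Polynomial.C (P.coeff 2) * Polynomial.X ^ 2 +
        Polynomial.C (P.coeff 1) * Polynomial.X + Polynomial.C (P.coeff 0) := by
      conv_lhs => rw [Polynomial.as_sum_range_C_mul_X_pow P, hn]
      simp [Finset.sum_range_succ]
      ring
    have hd' := congrArg (Polynomial.C (R := F[X])) hd
    simp only [map_mul, map_pow, map_ofNat] at hd'
    have h : S ^ 2 = Polynomial.C (4 * P.coeff 2) * (Polynomial.C (P.coeff 2) * Polynomial.X ^ 2 +
        Polynomial.C (P.coeff 1) * Polynomial.X + Polynomial.C (P.coeff 0)) := by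
      simp only [hS, map_mul, map_ofNat]
      linear_combination hd'
    rwa [← hPe] at h
  have hS0 : S ≠ 0 := by rintro h; rw [h] at hSdeg; simp at hSdeg
  have hC0 : Polynomial.C (4 * P.coeff 2) ≠ 0 := by
    rw [Ne, Polynomial.C_eq_zero, show (4 : F[X]) = 2 * 2 by norm_num]
    exact mul_ne_zero (mul_ne_zero h2' h2') ha
  obtain ⟨α, hα⟩ := IsAlgClosed.exists_eval₂_eq_zero_of_injective closureEmb closureEmb_injective S
    (by rw [Polynomial.degree_eq_natDegree hS0, hSdeg]; norm_num)
  -- Q is a prime of positive degree dividing S, so it divides no nonzero constant; S² = 4aP then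
  -- forces it to divide P twice, and the degree leaves only a constant cofactor.
  obtain ⟨Q, ⟨hQ0, hQ, -⟩, R, hR⟩ := exists_isMinPoly hS0 hα
  have hQC : ¬Q ∣ Polynomial.C (4 * P.coeff 2) := by
    intro h
    have := Polynomial.natDegree_le_of_dvd h hC0
    rw [Polynomial.natDegree_C] at this
    omega
  have hdvd : Q ∣ P :=
    (hQ.prime.dvd_or_dvd (hSP ▸ (Dvd.intro _ hR.symm).trans (dvd_pow_self S two_ne_zero))).resolve_left
      hQC
  obtain ⟨P', hP'⟩ := hdvd
  have hdvd' : Q ∣ P' := by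
    refine (hQ.prime.dvd_or_dvd (a := Polynomial.C (4 * P.coeff 2)) ⟨R ^ 2, ?_⟩).resolve_left hQC
    apply mul_left_cancel₀ hQ.ne_zero
    linear_combination (S + Q * R) * hR - hSP - Polynomial.C (4 * P.coeff 2) * hP'
  obtain ⟨G, rfl⟩ := hdvd'
  have hdeg : Q.natDegree ≤ 1 := hSdeg ▸ Polynomial.natDegree_le_of_dvd (Dvd.intro _ hR.symm) hS0
  have hG : P = Q ^ 2 * G := by rw [hP']; ring
  have hG0 : G.natDegree = 0 := by
    have h := congrArg Polynomial.natDegree hG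
    rw [Polynomial.natDegree_mul (pow_ne_zero 2 hQ.ne_zero) (by
      intro h; rw [h, mul_zero] at hG; exact hP hG), Polynomial.natDegree_pow, hn] at h
    omega
  obtain ⟨g, rfl⟩ := Polynomial.natDegree_eq_zero.mp hG0
  exact ⟨Q, g, hdeg, hG⟩

/-- In characteristic two, `F[T]` is spanned over its squares by `1` and `T`. -/
lemma exists_eq_sq_add_X_mul_sq (h2 : (2 : F) = 0) (a : F[X]) :
    ∃ u v : F[X], a = u ^ 2 + Polynomial.X * v ^ 2 := by
  have h2' : (2 : F[X]) = 0 := by rw [← Polynomial.C_ofNat, h2, map_zero]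
  have : CharP F 2 := CharTwo.of_one_ne_zero_of_two_eq_zero one_ne_zero h2
  have : Fintype F := Fintype.ofFinite F
  induction a using Polynomial.induction_on' with
  | add p q hp hq =>
    obtain ⟨u, v, rfl⟩ := hp
    obtain ⟨u', v', rfl⟩ := hq
    exact ⟨u + u', v + v', by linear_combination -(u * u' + Polynomial.X * v * v') * h2'⟩
  | monomial n c =>
    -- Finiteness of F enters here: a finite field of characteristic two is perfect, so the
    -- coefficient is a square.
    obtain ⟨d, rfl⟩ := FiniteField.isSquare_of_char_two (ringChar.eq F 2) c
    rw [← Polynomial.C_mul_X_pow_eq_monomial, map_mul]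
    rcases Nat.even_or_odd' n with ⟨k, rfl | rfl⟩
    · exact ⟨Polynomial.C d * Polynomial.X ^ k, 0, by ring⟩
    · exact ⟨0, Polynomial.C d * Polynomial.X ^ k, by ring⟩

lemma norm_polyEmb_X : ‖polyEmb (Polynomial.X : F[X])‖ = Nat.card F := by
  simpa using norm_polyEmb_X_pow (F := F) 1

/-- There is no cancellation in `x ^ 2 + T y ^ 2`, the two terms having different parity. -/
lemma norm_sq_add_X_mul_sq (x y : F⸨X⸩) :
    ‖x ^ 2 + polyEmb Polynomial.X * y ^ 2‖ = max (‖x‖ ^ 2) (Nat.card F * ‖y‖ ^ 2) := by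
  have hq := one_lt_card_real F
  have hn : ‖polyEmb Polynomial.X * y ^ 2‖ = Nat.card F * ‖y‖ ^ 2 := by
    rw [norm_mul, norm_pow, norm_polyEmb_X]
  rcases eq_or_ne x 0 with rfl | hx
  · rw [zero_pow two_ne_zero, zero_add, hn, norm_zero, zero_pow two_ne_zero, max_eq_right]
    positivity
  rcases eq_or_ne y 0 with rfl | hy
  · simp
  rw [← hn, ← norm_pow]
  apply IsUltrametricDist.norm_add_eq_max_of_norm_ne_norm
  rw [hn, norm_pow, norm_laurent hx, norm_laurent hy]
  intro h
  rw [← zpow_natCast, ← zpow_mul, ← zpow_natCast, ← zpow_mul, ← zpow_one_add₀ (by positivity)] at h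
  have := zpow_right_injective₀ (by positivity) hq.ne' h
  omega

/-- A polynomial with a double root is, for our purposes, not better than a linear one. -/
lemma exists_linear_of_disc_eq_zero {P : F[X][X]} (hn : P.natDegree = 2) {ξ : F⸨X⸩}
    (h0 : P.eval₂ polyEmb ξ ≠ 0) (hd : P.coeff 1 ^ 2 = 4 * P.coeff 2 * P.coeff 0) :
    ∃ L : F[X][X], L.natDegree ≤ 1 ∧ L.eval₂ polyEmb ξ ≠ 0 ∧ (height L : ℝ) ^ 2 ≤ height P ∧
      ‖L.eval₂ polyEmb ξ‖ ^ 2 ≤ ‖P.eval₂ polyEmb ξ‖ := by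
  by_cases h2 : (2 : F) = 0
  · have h2' : (2 : F[X]) = 0 := by rw [← Polynomial.C_ofNat, h2, map_zero]
    have h2K : (2 : F⸨X⸩) = 0 := by rw [← map_ofNat polyEmb, h2', map_zero]
    have hb : P.coeff 1 = 0 := by
      rw [show (4 : F[X]) = 2 * 2 by norm_num, h2', zero_mul, zero_mul, zero_mul] at hd
      exact pow_eq_zero_iff two_ne_zero |>.mp hd
    -- Here P = aX² + c need not be a constant times a square. Splitting a and c gives P = (uX + s)²
    -- + T(vX + t)², where neither heights nor values at ξ can cancel.
    obtain ⟨u, v, huv⟩ := exists_eq_sq_add_X_mul_sq h2 (P.coeff 2)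
    obtain ⟨s, t, hst⟩ := exists_eq_sq_add_X_mul_sq h2 (P.coeff 0)
    have hPξ : P.eval₂ polyEmb ξ = (polyEmb u * ξ + polyEmb s) ^ 2 +
        polyEmb Polynomial.X * (polyEmb v * ξ + polyEmb t) ^ 2 := by
      rw [eval₂_of_natDegree_le_two _ _ hn.le, hb, huv, hst]
      simp only [map_add, map_mul, map_pow, map_zero]
      linear_combination -(polyEmb u * ξ * polyEmb s +
        polyEmb Polynomial.X * polyEmb v * ξ * polyEmb t) * h2K
    have hq : 1 ≤ (Nat.card F : ℝ) := (one_lt_card_real F).le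
    have key : ∀ x y : F[X], ‖polyEmb x‖ ^ 2 ≤ height P → ‖polyEmb y‖ ^ 2 ≤ height P →
        (height (Polynomial.C x * Polynomial.X + Polynomial.C y) : ℝ) ^ 2 ≤ height P := by
      intro x y hx hy
      rw [← Real.le_sqrt (by simp) (by simp), height_le_iff (by positivity)]
      rw [← Real.le_sqrt (by simp) (by simp)] at hx hy
      intro i
      rcases i with _ | _ | i
      · simpa using hy
      · simpa using hx
      · simp
    have h2c := norm_coeff_le_height P 2
    have h0c := norm_coeff_le_height P 0
    rw [huv, map_add, map_mul, map_pow, map_pow, norm_sq_add_X_mul_sq, max_le_iff] at h2c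
    rw [hst, map_add, map_mul, map_pow, map_pow, norm_sq_add_X_mul_sq, max_le_iff] at h0c
    -- Since P(ξ) ≠ 0, at least one of the two linear forms is nonzero at ξ.
    by_cases hz : polyEmb u * ξ + polyEmb s = 0
    · refine ⟨Polynomial.C v * Polynomial.X + Polynomial.C t, Polynomial.natDegree_linear_le, ?_,
        key _ _ (le_trans (le_mul_of_one_le_left (by positivity) hq) h2c.2)
          (le_trans (le_mul_of_one_le_left (by positivity) hq) h0c.2), ?_⟩
      · intro h
        apply h0
        simp only [Polynomial.eval₂_add, Polynomial.eval₂_mul, Polynomial.eval₂_C,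
          Polynomial.eval₂_X] at h
        rw [hPξ, hz, h]; simp
      · rw [hPξ, norm_sq_add_X_mul_sq]
        refine le_max_of_le_right ?_
        simp only [Polynomial.eval₂_add, Polynomial.eval₂_mul, Polynomial.eval₂_C,
          Polynomial.eval₂_X]
        exact le_mul_of_one_le_left (by positivity) hq
    · refine ⟨Polynomial.C u * Polynomial.X + Polynomial.C s, Polynomial.natDegree_linear_le, ?_,
        key _ _ h2c.1 h0c.1, ?_⟩
      · simpa using hz
      · rw [hPξ, norm_sq_add_X_mul_sq]
        refine le_max_of_le_left ?_
        simp
  · obtain ⟨Q, g, hQ, rfl⟩ := exists_sq_dvd h2 hn hd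
    rw [Polynomial.eval₂_mul, Polynomial.eval₂_pow, Polynomial.eval₂_C] at h0 ⊢
    have hg : g ≠ 0 := by rintro rfl; simp at h0
    have hg' := one_le_norm_polyEmb hg
    refine ⟨Q, hQ, fun h => h0 (by rw [h]; simp), ?_, ?_⟩
    · rw [height_mul, pow_two, pow_two, height_mul]
      exact le_mul_of_one_le_right (by positivity) (one_le_height (by simpa using hg))
    · rw [norm_mul, norm_pow]
      exact le_mul_of_one_le_right (by positivity) hg'

/-- Small values of polynomials yield good algebraic approximations. -/
lemma minAlgDist_le_of_small {ξ : F⸨X⸩} {H : ℕ} {P : F[X][X]} (hH : (height P : ℝ) ≤ H)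
    (hn : P.natDegree ≤ 2) (h0 : P.eval₂ polyEmb ξ ≠ 0) (h1 : ‖P.eval₂ polyEmb ξ‖ < 1) :
    minAlgDist 2 ξ H ≤ ‖P.eval₂ polyEmb ξ‖ ∨
      minAlgDist 2 ξ (Nat.sqrt H) ^ 2 ≤ ‖P.eval₂ polyEmb ξ‖ := by
  have hroot : ∀ (Q : F[X][X]) (α : AlgebraicClosure F⸨X⸩), Q.eval₂ closureEmb α = 0 →
      Q.eval₂ polyEmb ξ ≠ 0 → α ≠ toClosure ξ := by
    rintro Q _ hα hξ rfl
    rw [eval₂_closureEmb, map_eq_zero] at hα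
    exact hξ hα
  have hne : ∀ Q : F[X][X], Q.eval₂ polyEmb ξ ≠ 0 → Q ≠ 0 := by rintro _ h rfl; simp at h
  by_cases hd : P.natDegree ≤ 1 ∨ P.coeff 1 ^ 2 ≠ 4 * P.coeff 2 * P.coeff 0
  · obtain ⟨α, hα, hle⟩ := exists_root_norm_sub_le hn h1 h0 hd
    exact Or.inl ((minAlgDist_le (hne P h0) hα hH hn (hroot P α hα h0)).trans hle)
  · push Not at hd
    obtain ⟨L, hL, hL0, hLh, hLξ⟩ := exists_linear_of_disc_eq_zero (by omega) h0 hd.2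
    have hL1 : ‖L.eval₂ polyEmb ξ‖ < 1 := by
      rw [← sq_lt_one_iff₀ (norm_nonneg _)]
      exact hLξ.trans_lt h1
    obtain ⟨α, hα, hle⟩ := exists_root_norm_sub_le (by omega) hL1 hL0 (Or.inl hL)
    -- Heights are powers of q, hence integers, so rounding √H down loses nothing.
    have hLn : (height L : ℝ) ≤ Nat.sqrt H := by
      obtain ⟨k, hk⟩ := exists_height_eq_pow (hne L hL0)
      have h := hLh.trans hH
      rw [hk] at h ⊢
      have h' : (Nat.card F ^ k) ^ 2 ≤ H := by exact_mod_cast h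
      have := Nat.le_sqrt'.mpr h'
      exact_mod_cast this
    have := (minAlgDist_le (n := 2) (hne L hL0) hα hLn (by omega) (hroot L α hα hL0)).trans hle
    refine Or.inr (le_trans (pow_le_pow_left₀ ?_ this 2) hLξ)
    exact Real.sInf_nonneg (by rintro _ ⟨α, -, -, rfl⟩; exact norm_nonneg (toClosure ξ - α))

/-- The loss of 1 is the normalising factor H in the definition of w₂*: a value |P(ξ)| < H^(-w)
gives an algebraic number within H^(-w), or one of height at most √H within H^(-w/2). For large H
both contradict w₂* < w - 1. -/
theorem mahlerExp_le_koksmaExp_add_one (ξ : F⸨X⸩) : mahlerExp 2 ξ ≤ koksmaExp 2 ξ + 1 := by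
  by_contra! hlt
  obtain ⟨w, hw1, hw2⟩ := EReal.lt_iff_exists_real_btwn.mp hlt
  have hk : koksmaExp 2 ξ < ((w - 1 : ℝ) : EReal) := by
    by_contra! hle
    have h := add_le_add_left hle 1
    rw [← EReal.coe_one, ← EReal.coe_add, sub_add_cancel] at h
    exact h.not_gt hw1
  have hw0 : 1 < w := by
    have := (koksmaExp_nonneg ξ).trans_lt hk
    rw [← EReal.coe_zero, EReal.coe_lt_coe_iff] at this
    linarith
  have hev : ∀ᶠ h : ℕ in Filter.atTop, (h : ℝ) ^ (-w) < minAlgDist 2 ξ h := by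
    filter_upwards [Filter.eventually_lt_of_limsup_lt hk, Filter.eventually_ge_atTop 2]
      with h hh hh2
    have hpos : (0 : ℝ) < h := by exact_mod_cast (by omega : 0 < h)
    have hd := minAlgDist_pos (n := 2) (by norm_num) ξ (by omega : 1 ≤ h)
    rw [EReal.coe_lt_coe_iff, div_lt_iff₀ (Real.log_pos (by exact_mod_cast hh2)),
      Real.log_mul hpos.ne' hd.ne'] at hh
    rw [← Real.log_lt_log_iff (by positivity) hd, Real.log_rpow hpos]
    linarith
  have hsqrt : Filter.Tendsto Nat.sqrt Filter.atTop Filter.atTop :=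
    Filter.tendsto_atTop.mpr fun b => by
      filter_upwards [Filter.eventually_ge_atTop (b * b)] with n hn
      exact Nat.le_sqrt.mpr hn
  have hev2 := hsqrt.eventually hev
  have hfr := Filter.frequently_lt_of_lt_limsup (by isBoundedDefault) hw2
  obtain ⟨H, hH, hH1, hH2, hH3⟩ :=
    (hfr.and_eventually (hev.and (hev2.and (Filter.eventually_ge_atTop 2)))).exists
  obtain ⟨P, h1, h2, h3, h4⟩ := exists_minPolyValue 2 ξ (by omega : 1 ≤ H)
  have hHpos : (0 : ℝ) < H := by exact_mod_cast (by omega : 0 < H)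
  have hH1' : (1 : ℝ) < H := by exact_mod_cast hH3
  rw [EReal.coe_lt_coe_iff, lt_div_iff₀ (Real.log_pos hH1'), h4] at hH
  have hsmall : ‖P.eval₂ polyEmb ξ‖ < (H : ℝ) ^ (-w) := by
    rw [← Real.log_lt_log_iff (norm_pos_iff.mpr h3) (by positivity), Real.log_rpow hHpos]
    linarith
  have hlt1 : (H : ℝ) ^ (-w) < 1 := Real.rpow_lt_one_of_one_lt_of_neg hH1' (by linarith)
  rcases minAlgDist_le_of_small h1 h2 h3 (hsmall.trans hlt1) with h | h
  · linarith
  · have hs : (0 : ℝ) < Nat.sqrt H := by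
      exact_mod_cast Nat.sqrt_pos.mpr (by omega : 0 < H)
    -- The square of the integer square root is at most H, and the exponent is negative.
    have h5 : (H : ℝ) ^ (-w) ≤ ((Nat.sqrt H : ℝ) ^ (-w)) ^ 2 := by
      rw [← Real.rpow_natCast, ← Real.rpow_mul hs.le, mul_comm, Real.rpow_mul hs.le,
        Real.rpow_natCast]
      apply Real.rpow_le_rpow_of_nonpos (by positivity) _ (by linarith)
      exact_mod_cast Nat.sqrt_le' H
    have h6 : ((Nat.sqrt H : ℝ) ^ (-w)) ^ 2 < minAlgDist 2 ξ (Nat.sqrt H) ^ 2 :=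
      pow_lt_pow_left₀ hH2 (by positivity) two_ne_zero
    linarith

/-! ### Quadratic series close to their conjugates -/

lemma norm_add_eq_left {E : Type*} [NormedField E] [IsUltrametricDist E] {x y : E}
    (h : ‖y‖ < ‖x‖) : ‖x + y‖ = ‖x‖ := by
  rw [IsUltrametricDist.norm_add_eq_max_of_norm_ne_norm h.ne', max_eq_left h.le]

/-- The fixed point `[0; W, W, …]`, where `s = 1 / W`. -/
lemma exists_eq_mul_one_sub_sq {s : F⸨X⸩} (hs : ‖s‖ < 1) :
    ∃ ω : F⸨X⸩, ω = s * (1 - ω ^ 2) ∧ ‖ω‖ = ‖s‖ := by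
  set f : F⸨X⸩ → F⸨X⸩ := fun x => s * (1 - x ^ 2) with hf
  set x : ℕ → F⸨X⸩ := fun n => f^[n] 0 with hx
  have hsucc : ∀ n, x (n + 1) = s * (1 - x n ^ 2) := fun n => Function.iterate_succ_apply' f n 0
  have hsub : ∀ y : F⸨X⸩, ‖y‖ ≤ 1 → ‖1 - y ^ 2‖ ≤ 1 := fun y hy => by
    rw [sub_eq_add_neg]
    exact norm_add_le_of_le' (by simp)
      (by rw [norm_neg, norm_pow]; exact pow_le_one₀ (norm_nonneg _) hy)
  have hle : ∀ n, ‖x n‖ ≤ 1 := by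
    intro n
    induction n with
    | zero => simp [hx]
    | succ n ih =>
      rw [hsucc, norm_mul]
      exact mul_le_one₀ hs.le (norm_nonneg _) (hsub _ ih)
  have hdist : ∀ n, dist (x n) (x (n + 1)) ≤ ‖s‖ * ‖s‖ ^ n := by
    intro n
    induction n with
    | zero =>
      rw [dist_eq_norm, hsucc]
      simp [hx]
    | succ n ih =>
      rw [dist_eq_norm] at ih ⊢
      -- The map contracts the unit ball by |s|, because |x n + x (n + 1)| ≤ 1 there.
      have : x (n + 1) - x (n + 1 + 1) = s * ((x n + x (n + 1)) * -(x n - x (n + 1))) := by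
        linear_combination hsucc n - hsucc (n + 1)
      rw [this, norm_mul, norm_mul, norm_neg, pow_succ']
      refine mul_le_mul_of_nonneg_left (le_trans (mul_le_of_le_one_left (norm_nonneg _) ?_) ih)
        (norm_nonneg s)
      exact norm_add_le_of_le' (hle _) (hle _)
  obtain ⟨ω, hω⟩ := cauchySeq_tendsto_of_complete (cauchySeq_of_le_geometric _ _ hs hdist)
  have hfix : ω = s * (1 - ω ^ 2) := by
    refine tendsto_nhds_unique ((Filter.tendsto_add_atTop_iff_nat 1).mpr hω) ?_
    simp only [hsucc]
    exact (tendsto_const_nhds.sub (hω.pow 2)).const_mul s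
  have h1 : ‖ω‖ ≤ 1 := le_of_tendsto' hω.norm hle
  have h2 : ‖ω‖ < 1 := by
    rw [hfix, norm_mul]
    exact (mul_le_of_le_one_right (norm_nonneg _) (hsub _ h1)).trans_lt hs
  refine ⟨ω, hfix, ?_⟩
  have h3 : ‖1 - ω ^ 2‖ = 1 := by
    rw [sub_eq_add_neg, norm_add_eq_left, norm_one]
    rw [norm_neg, norm_pow, norm_one]
    exact pow_lt_one₀ (norm_nonneg _) h2 two_ne_zero
  conv_lhs => rw [hfix]
  rw [norm_mul, h3, mul_one]

/-- `ω` is not rational, by descent. -/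
lemma eq_zero_of_mul_add_eq_zero {ω : F⸨X⸩} {W : F[X]} (hω : polyEmb W * ω = 1 - ω ^ 2)
    (hlt : ‖ω‖ < 1) (x y : F[X]) (h : polyEmb x * ω + polyEmb y = 0) : x = 0 ∧ y = 0 := by
  have hω0 : ω ≠ 0 := by rintro rfl; simp at hω
  induction hn : x.natDegree using Nat.strong_induction_on generalizing x y with
  | _ n ih =>
    rcases eq_or_ne x 0 with rfl | hx
    · rw [map_zero, zero_mul, zero_add, map_eq_zero_iff _ polyEmb_injective] at h
      exact ⟨rfl, h⟩
    · exfalso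
      have hy : polyEmb y = -(polyEmb x * ω) := by linear_combination h
      have hx' : polyEmb x ≠ 0 := (map_ne_zero_iff _ polyEmb_injective).mpr hx
      have hy0 : y ≠ 0 := by
        rw [← map_ne_zero_iff _ (polyEmb_injective (F := F)), hy]
        exact neg_ne_zero.mpr (mul_ne_zero hx' hω0)
      have hdeg : y.natDegree < x.natDegree := by
        rw [← pow_lt_pow_iff_right₀ (one_lt_card_real F), ← norm_polyEmb hx, ← norm_polyEmb hy0,
          hy, norm_neg, norm_mul]
        exact mul_lt_of_lt_one_right (norm_pos_iff.mpr hx') hlt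
      -- As W = ω⁻¹ - ω, dividing the relation xω + y = 0 by ω turns it into yω + (x + yW) = 0, with
      -- y of smaller degree than x.
      refine hy0 (ih _ (hn ▸ hdeg) y (x + y * W) ?_ rfl).1
      apply mul_left_cancel₀ hω0
      rw [map_add, map_mul]
      linear_combination h + polyEmb y * hω

variable (F) in
/-- A primitive quadratic polynomial `a X ^ 2 + b X + c` of height `q ^ (2 m + d)`, with two
irrational roots in `F((T⁻¹))` at distance `q ^ (-2 m)`. -/
structure CloseQuadratic (m d : ℕ) where
  (a b c : F[X])
  (α α' : F⸨X⸩)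
  norm_a : ‖polyEmb a‖ = (Nat.card F : ℝ) ^ (2 * m + d)
  emb_b : polyEmb b = -(polyEmb a * (α + α'))
  emb_c : polyEmb c = polyEmb a * (α * α')
  norm_lt : ‖α‖ < 1
  norm_le' : ‖α'‖ ≤ 1
  norm_sub : ‖α - α'‖ = ((Nat.card F : ℝ) ^ (2 * m))⁻¹
  irrational : ∀ x y : F[X], polyEmb x * α + polyEmb y = 0 → x = 0 ∧ y = 0
  irrational' : ∀ x y : F[X], polyEmb x * α' + polyEmb y = 0 → x = 0 ∧ y = 0
  primitive : ∃ x y : F[X], a * x ^ 2 + b * (x * y) + c * y ^ 2 = 1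

/-- A unimodular matrix over `F[T]` whose second column approximates a given series. -/
lemma exists_unimodular {α₀ : F⸨X⸩} (hα₀ : ‖α₀‖ < 1) {m : ℕ} (hm : 2 ≤ m) :
    ∃ A B C : F[X], A * Polynomial.X ^ m - B * C = 1 ∧ ‖polyEmb C‖ = (Nat.card F : ℝ) ^ m ∧
      ‖polyEmb A‖ ≤ ‖polyEmb B‖ ∧ ‖polyEmb B‖ < (Nat.card F : ℝ) ^ m ∧
      ‖polyEmb (Polynomial.X ^ m) * α₀ - polyEmb B‖ = Nat.card F := by
  have hq := one_lt_card_real F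
  obtain ⟨B', hB'⟩ := exists_polyPart (polyEmb (Polynomial.X ^ m) * α₀)
  -- A nonzero constant term will make B coprime to T^m.
  obtain ⟨c, hc⟩ : ∃ c : F, B'.coeff 0 + c ≠ 0 := by
    by_cases h : B'.coeff 0 = 0
    · exact ⟨1, by simp [h]⟩
    · exact ⟨0, by simpa using h⟩
  -- The shift by T + c makes the distance from T^m α₀ exactly q, not merely small; exact distances
  -- are what the limit construction needs.
  set B := B' + (Polynomial.X + Polynomial.C c) with hB
  have hB0 : B.coeff 0 ≠ 0 := by simpa [hB] using hc
  have hBne : B ≠ 0 := by rintro h; simp [h] at hB0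
  have hdist : ‖polyEmb (Polynomial.X ^ m) * α₀ - polyEmb B‖ = Nat.card F := by
    have h1 : ‖-polyEmb (Polynomial.X + Polynomial.C c)‖ = Nat.card F := by
      rw [norm_neg, norm_polyEmb (Polynomial.X_add_C_ne_zero c), Polynomial.natDegree_X_add_C,
        pow_one]
    have : polyEmb (Polynomial.X ^ m) * α₀ - polyEmb B = -polyEmb (Polynomial.X + Polynomial.C c)
        + (polyEmb (Polynomial.X ^ m) * α₀ - polyEmb B') := by
      rw [hB, map_add polyEmb B']; ring
    rw [this, norm_add_eq_left, h1]
    rw [h1]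
    exact hB'.trans_lt ((inv_lt_one_of_one_lt₀ hq).trans hq)
  have hBlt : ‖polyEmb B‖ < (Nat.card F : ℝ) ^ m := by
    have : polyEmb B = polyEmb (Polynomial.X ^ m) * α₀ +
      -(polyEmb (Polynomial.X ^ m) * α₀ - polyEmb B) := by ring
    rw [this]
    refine (IsUltrametricDist.norm_add_le_max _ _).trans_lt (max_lt ?_ ?_)
    · rw [norm_mul, norm_polyEmb_X_pow]
      exact mul_lt_of_lt_one_right (by positivity) hα₀
    · rw [norm_neg, hdist]
      exact lt_self_pow₀ hq (by omega)
  have hcop : IsCoprime (Polynomial.X ^ m) B := by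
    apply IsCoprime.pow_left
    rw [Polynomial.irreducible_X.coprime_iff_not_dvd, Polynomial.X_dvd_iff]
    exact hB0
  obtain ⟨A₀, C₀, hAC⟩ := hcop
  have hmon : (Polynomial.X ^ m : F[X]).Monic := Polynomial.monic_X_pow m
  have hdm := Polynomial.modByMonic_add_div (-C₀) (Polynomial.X ^ m)
  have hlt := Polynomial.degree_modByMonic_lt (-C₀) hmon
  set r := (-C₀) %ₘ Polynomial.X ^ m
  set k := (-C₀) /ₘ Polynomial.X ^ m
  -- The lower left entry matters only modulo T^m; taking T^m plus the remainder gives it absolute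
  -- value exactly q^m.
  have hdet : (A₀ + (1 - k) * B) * Polynomial.X ^ m - B * (Polynomial.X ^ m + r) = 1 := by
    linear_combination hAC - B * hdm
  have hC : ‖polyEmb (Polynomial.X ^ m + r)‖ = (Nat.card F : ℝ) ^ m := by
    have h := Polynomial.natDegree_add_eq_left_of_degree_lt hlt
    rw [Polynomial.natDegree_X_pow] at h
    rw [norm_polyEmb (by intro h0; rw [h0] at h; simp at h; omega), h]
  refine ⟨A₀ + (1 - k) * B, B, Polynomial.X ^ m + r, hdet, hC, ?_, hBlt, hdist⟩
  have h1 : polyEmb (A₀ + (1 - k) * B) * polyEmb (Polynomial.X ^ m)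
      = 1 + polyEmb B * polyEmb (Polynomial.X ^ m + r) := by
    rw [← map_mul, ← map_mul, ← map_one polyEmb, ← map_add]
    congr 1
    linear_combination hdet
  have h2 : ‖polyEmb (A₀ + (1 - k) * B)‖ * (Nat.card F : ℝ) ^ m
      ≤ ‖polyEmb B‖ * (Nat.card F : ℝ) ^ m := by
    conv_lhs => rw [← norm_polyEmb_X_pow, ← norm_mul, h1]
    apply norm_add_le_of_le'
    · rw [norm_one]
      exact one_le_mul_of_one_le_of_one_le (one_le_norm_polyEmb hBne) (one_le_pow₀ hq.le)
    · rw [norm_mul, hC]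
  exact le_of_mul_le_mul_right h2 (by positivity)

/-- Every series of absolute value less than one is approximated by a root of a `CloseQuadratic`. -/
lemma exists_closeQuadratic {α₀ : F⸨X⸩} (hα₀ : ‖α₀‖ < 1) {m d : ℕ} (hm : 2 ≤ m) (hd : 1 ≤ d) :
    ∃ D : CloseQuadratic F m d, ‖D.α - α₀‖ = Nat.card F / (Nat.card F : ℝ) ^ m := by
  have hq := one_lt_card_real F
  set q : ℝ := (Nat.card F : ℝ) with hqdef
  have hq0 : 0 < q := by positivity
  obtain ⟨A, B, C, hdet, hC, hAB, hB, hdist⟩ := exists_unimodular hα₀ hm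
  set E : F[X] := Polynomial.X ^ m with hEdef
  set W : F[X] := Polynomial.X ^ d with hWdef
  have hW : ‖polyEmb W‖ = q ^ d := norm_polyEmb_X_pow d
  have hE : ‖polyEmb E‖ = q ^ m := norm_polyEmb_X_pow m
  have hqd : 1 < q ^ d := one_lt_pow₀ hq (by omega)
  have hqm : 0 < q ^ m := by positivity
  have hW0 : polyEmb W ≠ 0 := norm_pos_iff.mp (by rw [hW]; positivity)
  have hE0 : polyEmb E ≠ 0 := norm_pos_iff.mp (by rw [hE]; positivity)
  -- ω and ω' = -(W + ω) are the roots of X² + WX - 1, of sizes q^(-d) and q^d; since W ≠ 0 they are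
  -- distinct in every characteristic.
  obtain ⟨ω, hω, hωn⟩ := exists_eq_mul_one_sub_sq (s := (polyEmb W)⁻¹)
    (by rw [norm_inv, hW]; exact inv_lt_one_of_one_lt₀ hqd)
  rw [norm_inv, hW] at hωn
  have hω1 : ‖ω‖ < 1 := by rw [hωn]; exact inv_lt_one_of_one_lt₀ hqd
  replace hω : polyEmb W * ω = 1 - ω ^ 2 := by
    rw [eq_inv_mul_iff_mul_eq₀ hW0] at hω; exact hω
  set ω' := -(polyEmb W + ω) with hω'def
  have hω' : ‖ω'‖ = q ^ d := by
    rw [hω'def, norm_neg, norm_add_eq_left, hW]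
    rw [hW]; exact hω1.trans hqd
  have hsum : ω + ω' = -polyEmb W := by rw [hω'def]; ring
  have hprod : ω * ω' = -1 := by rw [hω'def]; linear_combination -hω
  have hdet' : polyEmb A * polyEmb E - polyEmb B * polyEmb C = 1 := by
    rw [← map_mul, ← map_mul, ← map_sub, hdet, map_one]
  have hn : ‖polyEmb C * ω + polyEmb E‖ = q ^ m := by
    rw [add_comm, norm_add_eq_left, hE]
    rw [hE, norm_mul, hC]
    exact mul_lt_of_lt_one_right hqm hω1
  have hn' : ‖polyEmb C * ω' + polyEmb E‖ = q ^ m * q ^ d := by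
    rw [norm_add_eq_left, norm_mul, hC, hω']
    rw [norm_mul, hC, hω', hE]
    exact lt_mul_of_one_lt_right hqm hqd
  have hN0 : polyEmb C * ω + polyEmb E ≠ 0 := norm_pos_iff.mp (by rw [hn]; positivity)
  have hN0' : polyEmb C * ω' + polyEmb E ≠ 0 := norm_pos_iff.mp (by rw [hn']; positivity)
  -- A Möbius map of determinant 1 divides ω - ω', of size q^d, by two denominators of sizes q^m and
  -- q^(m + d), leaving q^(-2m).
  set α := (polyEmb A * ω + polyEmb B) / (polyEmb C * ω + polyEmb E) with hα
  set α' := (polyEmb A * ω' + polyEmb B) / (polyEmb C * ω' + polyEmb E) with hα'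
  have hαm : α * (polyEmb C * ω + polyEmb E) = polyEmb A * ω + polyEmb B := div_mul_cancel₀ _ hN0
  have hαm' : α' * (polyEmb C * ω' + polyEmb E) = polyEmb A * ω' + polyEmb B :=
    div_mul_cancel₀ _ hN0'
  have ha : polyEmb (E ^ 2 - W * E * C - C ^ 2)
      = (polyEmb C * ω + polyEmb E) * (polyEmb C * ω' + polyEmb E) := by
    simp only [map_sub, map_mul, map_pow]
    linear_combination -polyEmb C * polyEmb E * hsum - polyEmb C ^ 2 * hprod
  have hirr := eq_zero_of_mul_add_eq_zero hω hω1
  have hmat : ∀ x y : F[X], x * A + y * C = 0 → x * B + y * E = 0 → x = 0 ∧ y = 0 := by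
    intro x y h1 h2
    constructor
    · linear_combination E * h1 - C * h2 - x * hdet
    · linear_combination A * h2 - B * h1 - y * hdet
  -- The leading coefficient is the norm (Cω + E)(Cω' + E). The quadratic form takes the value (AE -
  -- BC)² = 1 at (A, C), whence primitivity.
  refine ⟨⟨E ^ 2 - W * E * C - C ^ 2, -2 * (E * B) + W * (E * A + B * C) + 2 * (A * C),
    B ^ 2 - W * A * B - A ^ 2, α, α', ?_, ?_, ?_, ?_, ?_, ?_, ?_, ?_, ⟨A, C, ?_⟩⟩, ?_⟩
  · rw [ha, norm_mul, hn, hn']; ring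
  · rw [ha]
    have : -((polyEmb C * ω + polyEmb E) * (polyEmb C * ω' + polyEmb E) * (α + α'))
      = -((polyEmb A * ω + polyEmb B) * (polyEmb C * ω' + polyEmb E) +
        (polyEmb A * ω' + polyEmb B) * (polyEmb C * ω + polyEmb E)) := by
      rw [← hαm, ← hαm']; ring
    rw [this]
    simp only [map_add, map_mul, map_neg, map_ofNat]
    linear_combination (polyEmb A * polyEmb E + polyEmb B * polyEmb C) * hsum +
      2 * polyEmb A * polyEmb C * hprod
  · rw [ha]
    have : (polyEmb C * ω + polyEmb E) * (polyEmb C * ω' + polyEmb E) * (α * α')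
      = (polyEmb A * ω + polyEmb B) * (polyEmb A * ω' + polyEmb B) := by
      rw [← hαm, ← hαm']; ring
    rw [this]
    simp only [map_sub, map_mul, map_pow]
    linear_combination -polyEmb A * polyEmb B * hsum - polyEmb A ^ 2 * hprod
  · rw [hα, norm_div, hn, div_lt_one hqm]
    refine lt_of_le_of_lt (norm_add_le_of_le' ?_ le_rfl) hB
    rw [norm_mul]
    exact (mul_le_of_le_one_right (norm_nonneg _) hω1.le).trans hAB
  · rw [hα', norm_div, hn', div_le_one (by positivity)]
    apply norm_add_le_of_le'
    · rw [norm_mul, hω']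
      gcongr
      exact hAB.trans hB.le
    · exact hB.le.trans (le_mul_of_one_le_right hqm.le hqd.le)
  · have : α - α' = (ω - ω') / ((polyEmb C * ω + polyEmb E) * (polyEmb C * ω' + polyEmb E)) := by
      rw [hα, hα', div_sub_div _ _ hN0 hN0']
      congr 1
      linear_combination (ω - ω') * hdet'
    have h2 : ‖ω - ω'‖ = q ^ d := by
      have : ω - ω' = polyEmb W + (ω + ω) := by rw [hω'def]; ring
      rw [this, norm_add_eq_left, hW]
      rw [hW]
      exact (norm_add_le_of_le' hω1.le hω1.le).trans_lt hqd
    change _ = (q ^ (2 * m))⁻¹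
    rw [this, norm_div, norm_mul, hn, hn', h2]
    field_simp
    ring
  · intro x y h
    have := hirr (x * A + y * C) (x * B + y * E) (by
      simp only [map_add, map_mul]
      linear_combination (polyEmb C * ω + polyEmb E) * h - polyEmb x * hαm)
    exact hmat x y this.1 this.2
  · intro x y h
    -- Substituting ω' = -(W + ω) turns a relation for ω' into one for ω.
    have := hirr (-(x * A + y * C)) ((x * B + y * E) - (x * A + y * C) * W) (by
      simp only [map_add, map_sub, map_mul, map_neg]
      linear_combination (polyEmb C * ω' + polyEmb E) * h - polyEmb x * hαm' -
        (polyEmb x * polyEmb A + polyEmb y * polyEmb C) * hsum)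
    have h1 : x * A + y * C = 0 := neg_eq_zero.mp this.1
    exact hmat x y h1 (by simpa [h1] using this.2)
  · linear_combination (A * E - B * C + 1) * hdet
  · have h1 : α - polyEmb B / polyEmb E = ω / (polyEmb E * (polyEmb C * ω + polyEmb E)) := by
      rw [hα, div_sub_div _ _ hN0 hE0, mul_comm (polyEmb E)]
      congr 1
      linear_combination ω * hdet'
    have h2 : ‖polyEmb B / polyEmb E - α₀‖ = q / q ^ m := by
      have : polyEmb B / polyEmb E - α₀ = -(polyEmb E * α₀ - polyEmb B) / polyEmb E := by
        field_simp; ring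
      rw [this, norm_div, norm_neg, hdist, hE]
    -- α is closer to B / E than α₀ is, so |α - α₀| equals |B / E - α₀| exactly.
    have h3 : ‖α - polyEmb B / polyEmb E‖ < q / q ^ m := by
      rw [h1, norm_div, norm_mul, hE, hn]
      apply (div_lt_div_of_pos_right hω1 (by positivity)).trans
      rw [div_lt_div_iff₀ (by positivity) hqm, one_mul]
      have : 1 ≤ q ^ m := one_le_pow₀ hq.le
      nlinarith [mul_pos hqm hqm]
    have : α - α₀ = (polyEmb B / polyEmb E - α₀) + (α - polyEmb B / polyEmb E) := by ring
    simp only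
    rw [this, norm_add_eq_left, h2]
    rwa [h2]

lemma eval₂_polyEmb_sub_le {P : F[X][X]} (hn : P.natDegree ≤ 2) {ξ α : F⸨X⸩}
    (hξ : ‖ξ‖ ≤ 1) (hα : ‖α‖ ≤ 1) :
    ‖P.eval₂ polyEmb ξ - P.eval₂ polyEmb α‖ ≤ height P * ‖ξ - α‖ := by
  have h := norm_eval₂_le hn le_rfl (ξ := toClosure ξ) (α := toClosure α)
    (by rwa [norm_algebraMap_closure]) (by rwa [norm_algebraMap_closure])
  rwa [eval₂_closureEmb, eval₂_closureEmb, ← map_sub, ← map_sub, norm_algebraMap_closure,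
    norm_algebraMap_closure, mul_one] at h

lemma norm_eval₂_polyEmb_le {P : F[X][X]} (hn : P.natDegree ≤ 2) {x : F⸨X⸩} (hx : ‖x‖ ≤ 1) :
    ‖P.eval₂ polyEmb x‖ ≤ height P := by
  rw [eval₂_of_natDegree_le_two _ _ hn]
  have h : ∀ (i k : ℕ), ‖polyEmb (P.coeff i) * x ^ k‖ ≤ height P := fun i k => by
    rw [norm_mul, norm_pow]
    exact (mul_le_of_le_one_right (norm_nonneg _) (pow_le_one₀ (norm_nonneg _) hx)).trans
      (norm_coeff_le_height P i)
  exact norm_add_le_of_le' (norm_add_le_of_le' (h 2 2) (by simpa using h 1 1)) (by simpa using h 0 0)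

/-! ### Lower bounds from the resultant -/

namespace CloseQuadratic

variable {m d : ℕ} (D : CloseQuadratic F m d)

/-- The polynomial `a X ^ 2 + b X + c`. -/
def poly : F[X][X] :=
  Polynomial.C D.a * Polynomial.X ^ 2 + Polynomial.C D.b * Polynomial.X + Polynomial.C D.c

lemma a_ne_zero : D.a ≠ 0 := by
  intro h
  have h2 := D.norm_a
  have := one_lt_card_real F
  rw [h, map_zero, norm_zero] at h2
  exact (pow_pos (by linarith) _).ne h2

lemma natDegree_poly_le : D.poly.natDegree ≤ 2 := Polynomial.natDegree_quadratic_le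

lemma coeff_poly_two : D.poly.coeff 2 = D.a := by simp [poly]

lemma coeff_poly_one : D.poly.coeff 1 = D.b := by simp [poly, Polynomial.coeff_C]

lemma coeff_poly_zero : D.poly.coeff 0 = D.c := by simp [poly]

lemma poly_ne_zero : D.poly ≠ 0 := by
  intro h
  apply D.a_ne_zero
  rw [← D.coeff_poly_two, h, Polynomial.coeff_zero]

lemma height_poly : (height D.poly : ℝ) = (Nat.card F : ℝ) ^ (2 * m + d) := by
  apply le_antisymm
  · rw [height_le_iff (by positivity)]
    intro i
    rcases i with _ | _ | _ | i
    · rw [D.coeff_poly_zero, D.emb_c, norm_mul, D.norm_a, norm_mul]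
      exact mul_le_of_le_one_right (by positivity)
        (mul_le_one₀ D.norm_lt.le (norm_nonneg _) D.norm_le')
    · rw [zero_add, D.coeff_poly_one, D.emb_b, norm_neg, norm_mul, D.norm_a]
      exact mul_le_of_le_one_right (by positivity) (norm_add_le_of_le' D.norm_lt.le D.norm_le')
    · rw [zero_add, one_add_one_eq_two, D.coeff_poly_two, D.norm_a]
    · rw [Polynomial.coeff_eq_zero_of_natDegree_lt (lt_of_le_of_lt D.natDegree_poly_le (by omega))]
      simp
  · rw [← D.norm_a, ← D.coeff_poly_two]
    exact norm_coeff_le_height _ _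

lemma eval_poly (x : F⸨X⸩) :
    D.poly.eval₂ polyEmb x = polyEmb D.a * ((x - D.α) * (x - D.α')) := by
  rw [eval₂_of_natDegree_le_two _ _ D.natDegree_poly_le, D.coeff_poly_zero, D.coeff_poly_one,
    D.coeff_poly_two, D.emb_b, D.emb_c]
  ring

lemma eval_closure_poly (x : AlgebraicClosure F⸨X⸩) :
    D.poly.eval₂ closureEmb x =
      closureEmb D.a * ((x - toClosure D.α) * (x - toClosure D.α')) := by
  rw [eval₂_of_natDegree_le_two _ _ D.natDegree_poly_le, D.coeff_poly_zero, D.coeff_poly_one,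
    D.coeff_poly_two]
  simp only [RingHom.comp_apply, D.emb_b, D.emb_c, map_neg, map_mul, map_add]
  ring

/-- A polynomial of degree at most two with a root in common with `D.poly` is a multiple of it. -/
lemma eq_C_mul_poly {x : F⸨X⸩} (hx : ∀ u v : F[X], polyEmb u * x + polyEmb v = 0 → u = 0 ∧ v = 0)
    (hDx : D.poly.eval₂ polyEmb x = 0) {Q : F[X][X]} (hQ : Q.natDegree ≤ 2)
    (hQx : Q.eval₂ polyEmb x = 0) : ∃ g : F[X], Q = Polynomial.C g * D.poly := by
  rw [eval₂_of_natDegree_le_two _ _ D.natDegree_poly_le, D.coeff_poly_zero, D.coeff_poly_one,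
    D.coeff_poly_two] at hDx
  rw [eval₂_of_natDegree_le_two _ _ hQ] at hQx
  -- Eliminating x² leaves a linear relation for the irrational x, so Q and `D.poly` have
  -- proportional coefficients.
  obtain ⟨h1, h2⟩ := hx (D.a * Q.coeff 1 - Q.coeff 2 * D.b) (D.a * Q.coeff 0 - Q.coeff 2 * D.c) (by
    simp only [map_sub, map_mul]
    linear_combination polyEmb D.a * hQx - polyEmb (Q.coeff 2) * hDx)
  obtain ⟨s, t, hst⟩ := D.primitive
  -- The form of `D.poly` is 1 at (s, t), so the proportionality factor is the value there of the
  -- form of Q, and it lies in F[T].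
  set g := Q.coeff 2 * s ^ 2 + Q.coeff 1 * (s * t) + Q.coeff 0 * t ^ 2 with hg
  have e2 : Q.coeff 2 = g * D.a := by
    linear_combination -Q.coeff 2 * hst - s * t * h1 - t ^ 2 * h2
  have e1 : Q.coeff 1 = g * D.b := by
    apply mul_left_cancel₀ D.a_ne_zero
    linear_combination h1 + D.b * e2
  have e0 : Q.coeff 0 = g * D.c := by
    apply mul_left_cancel₀ D.a_ne_zero
    linear_combination h2 + D.c * e2
  refine ⟨g, ?_⟩
  ext1 i
  rw [Polynomial.coeff_C_mul]
  rcases i with _ | _ | _ | i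
  · rw [D.coeff_poly_zero, e0]
  · rw [zero_add, D.coeff_poly_one, e1]
  · rw [zero_add, one_add_one_eq_two, D.coeff_poly_two, e2]
  · rw [Polynomial.coeff_eq_zero_of_natDegree_lt (lt_of_le_of_lt D.natDegree_poly_le (by omega)),
      Polynomial.coeff_eq_zero_of_natDegree_lt (lt_of_le_of_lt hQ (by omega)), mul_zero]

/-- The resultant of `D.poly` and `Q` bounds `Q(α)` from below. -/
lemma one_le_norm_resultant {Q : F[X][X]} (hQ : Q.natDegree ≤ 2)
    (hne : ∀ g : F[X], Q ≠ Polynomial.C g * D.poly) :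
    1 ≤ ‖polyEmb D.a‖ ^ 2 * (‖Q.eval₂ polyEmb D.α‖ * ‖Q.eval₂ polyEmb D.α'‖) := by
  have h1 : Q.eval₂ polyEmb D.α ≠ 0 := fun h => by
    obtain ⟨g, hg⟩ := D.eq_C_mul_poly D.irrational (by rw [D.eval_poly]; simp) hQ h
    exact hne g hg
  have h2 : Q.eval₂ polyEmb D.α' ≠ 0 := fun h => by
    obtain ⟨g, hg⟩ := D.eq_C_mul_poly D.irrational' (by rw [D.eval_poly]; simp) hQ h
    exact hne g hg
  have h3 : polyEmb D.a ≠ 0 := (map_ne_zero_iff _ polyEmb_injective).mpr D.a_ne_zero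
  -- The right-hand side is the explicit resultant of two quadratics, an element of F[T].
  have key : polyEmb D.a ^ 2 * (Q.eval₂ polyEmb D.α * Q.eval₂ polyEmb D.α') =
      polyEmb ((D.a * Q.coeff 0 - D.c * Q.coeff 2) ^ 2 -
        (D.a * Q.coeff 1 - D.b * Q.coeff 2) * (D.b * Q.coeff 0 - D.c * Q.coeff 1)) := by
    rw [eval₂_of_natDegree_le_two _ _ hQ, eval₂_of_natDegree_le_two _ _ hQ]
    simp only [map_sub, map_mul, map_pow, D.emb_b, D.emb_c]
    ring
  rw [← norm_mul, ← norm_pow, ← norm_mul, key]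
  apply one_le_norm_polyEmb
  intro h0
  rw [h0, map_zero] at key
  exact mul_ne_zero (pow_ne_zero 2 h3) (mul_ne_zero h1 h2) key

/-- If `D.α` is very close to `ξ`, then `Q(ξ)` is not too small. -/
lemma one_le_mul_norm_eval {Q : F[X][X]} (hQ : Q.natDegree ≤ 2)
    (hne : ∀ g : F[X], Q ≠ Polynomial.C g * D.poly) {ξ : F⸨X⸩} (hξ : ‖ξ‖ ≤ 1)
    (hlt : ‖polyEmb D.a‖ ^ 2 * (height Q ^ 2 * ‖ξ - D.α‖) < 1) :
    1 ≤ ‖polyEmb D.a‖ ^ 2 * (height Q * ‖Q.eval₂ polyEmb ξ‖) := by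
  have h := D.one_le_norm_resultant hQ hne
  have h' := norm_eval₂_polyEmb_le hQ D.norm_le'
  have hd := eval₂_polyEmb_sub_le hQ hξ D.norm_lt.le
  have hmax : ‖Q.eval₂ polyEmb D.α‖ ≤ max ‖Q.eval₂ polyEmb ξ‖ (height Q * ‖ξ - D.α‖) := by
    have : Q.eval₂ polyEmb D.α = Q.eval₂ polyEmb ξ +
        -(Q.eval₂ polyEmb ξ - Q.eval₂ polyEmb D.α) := by ring
    rw [this]
    refine (IsUltrametricDist.norm_add_le_max _ _).trans (max_le_max le_rfl ?_)
    rwa [norm_neg]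
  have h2 : 1 ≤ ‖polyEmb D.a‖ ^ 2 *
      (max ‖Q.eval₂ polyEmb ξ‖ (height Q * ‖ξ - D.α‖) * height Q) :=
    h.trans (by gcongr)
  rcases max_cases ‖Q.eval₂ polyEmb ξ‖ (height Q * ‖ξ - D.α‖) with ⟨e, -⟩ | ⟨e, -⟩
  · rw [e] at h2
    rwa [mul_comm (height Q : ℝ)]
  · rw [e] at h2
    exfalso
    have : ‖polyEmb D.a‖ ^ 2 * (height Q ^ 2 * ‖ξ - D.α‖) =
      ‖polyEmb D.a‖ ^ 2 * (height Q * ‖ξ - D.α‖ * height Q) := by ring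
    linarith

end CloseQuadratic

/-! ### Construction of ξ -/

/-- A sequence of quadratic approximations of `ξ`, the `j`-th of height `q ^ h` and at distance
`q ^ (1 - K h)`, with `h = 2 m j + d j` and `d j = (1 - δ) h + O(1)`. -/
structure QuadraticApprox (ξ : F⸨X⸩) (K : ℕ) (δ : ℝ) where
  (m d : ℕ → ℕ)
  D : ∀ j, CloseQuadratic F (m j) (d j)
  two_le : ∀ j, 2 ≤ m j
  m_succ : ∀ j, m (j + 1) = K * (2 * m j + d j)
  le_d : ∀ j, (1 - δ) * (2 * m j + d j) ≤ d j
  d_le : ∀ j, (d j : ℝ) ≤ (1 - δ) * (2 * m j + d j) + 2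
  norm_sub : ∀ j, ‖ξ - (D j).α‖ = Nat.card F / (Nat.card F : ℝ) ^ m (j + 1)

/-- Solving d = (1 - δ)(2m + d) gives d = 2m(1 - δ)/δ, which needs δ > 0. The extra 1 after rounding
up keeps d positive even when δ = 1. -/
lemma exists_ceil {δ : ℝ} (hδ : 0 < δ) (hδ1 : δ ≤ 1) (m : ℕ) :
    ∃ d : ℕ, 1 ≤ d ∧ (1 - δ) * (2 * m + d) ≤ d ∧ (d : ℝ) ≤ (1 - δ) * (2 * m + d) + 2 := by
  have h0 : 0 ≤ (1 - δ) * (2 * m) / δ := by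
    have : 0 ≤ 1 - δ := by linarith
    positivity
  have h1 := Nat.le_ceil ((1 - δ) * (2 * m) / δ)
  have h2 := Nat.ceil_lt_add_one h0
  refine ⟨⌈(1 - δ) * (2 * m) / δ⌉₊ + 1, by omega, ?_, ?_⟩
  · rw [div_le_iff₀ hδ] at h1
    push_cast
    nlinarith
  · rw [← sub_lt_iff_lt_add, lt_div_iff₀ hδ] at h2
    push_cast
    nlinarith

/-- Each root is chosen at an exact distance from the preceding one. These distances strictly
decrease, so by the ultrametric inequality the distance from α_j to the limit is that of its first
step. -/
lemma exists_quadraticApprox (F : Type*) [Field F] [Finite F] {K : ℕ} (hK : 1 ≤ K) {δ : ℝ}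
    (hδ : 0 < δ) (hδ1 : δ ≤ 1) :
    ∃ ξ : F⸨X⸩, ‖ξ‖ ≤ 1 ∧ Nonempty (QuadraticApprox ξ K δ) := by
  have hq := one_lt_card_real F
  choose e he1 he2 he3 using exists_ceil hδ hδ1
  let m : ℕ → ℕ := fun j => (fun n => K * (2 * n + e n))^[j] 2
  have hms : ∀ j, m (j + 1) = K * (2 * m j + e (m j)) := fun j =>
    Function.iterate_succ_apply' _ _ _
  have hlt : ∀ j, m j < m (j + 1) := fun j => by
    rw [hms]
    have := he1 (m j)
    nlinarith [Nat.zero_le (m j)]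
  have hmono : StrictMono m := strictMono_nat_of_lt_succ hlt
  have hm2 : ∀ j, 2 ≤ m j := fun j => hmono.monotone (Nat.zero_le j)
  obtain ⟨D₀, -⟩ := exists_closeQuadratic (F := F) (α₀ := 0) (by simp) (hm2 0) (he1 (m 0))
  have hstep : ∀ (j : ℕ) (D : CloseQuadratic F (m j) (e (m j))),
      ∃ D' : CloseQuadratic F (m (j + 1)) (e (m (j + 1))),
        ‖D'.α - D.α‖ = Nat.card F / (Nat.card F : ℝ) ^ m (j + 1) :=
    fun j D => exists_closeQuadratic D.norm_lt (hm2 _) (he1 _)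
  choose next hnext using hstep
  let D : ∀ j, CloseQuadratic F (m j) (e (m j)) := fun j => Nat.rec D₀ next j
  let a : ℕ → F⸨X⸩ := fun j => (D j).α
  have hD : ∀ j, ‖a (j + 1) - a j‖ = Nat.card F / (Nat.card F : ℝ) ^ m (j + 1) :=
    fun j => hnext j (D j)
  have hanti : ∀ i j, i < j → (Nat.card F / (Nat.card F : ℝ) ^ m j) <
      Nat.card F / (Nat.card F : ℝ) ^ m i := by
    intro i j hij
    gcongr
    exact hmono hij
  have hfar : ∀ j n, ‖a (j + 1 + n) - a j‖ = Nat.card F / (Nat.card F : ℝ) ^ m (j + 1) := by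
    intro j n
    induction n with
    | zero => exact hD j
    | succ n ih =>
      have : a (j + 1 + (n + 1)) - a j = (a (j + 1 + n) - a j) +
        (a (j + 1 + n + 1) - a (j + 1 + n)) := by rw [← add_assoc]; ring
      rw [this, norm_add_eq_left, ih]
      rw [ih, hD]
      exact hanti _ _ (by omega)
  have hcauchy : CauchySeq a := by
    apply cauchySeq_of_le_geometric (Nat.card F : ℝ)⁻¹ (Nat.card F : ℝ) (inv_lt_one_of_one_lt₀ hq)
    intro j
    rw [dist_comm, dist_eq_norm, hD, inv_pow, div_eq_mul_inv]
    have : j ≤ m (j + 1) := (hmono.le_apply (x := j)).trans (hlt j).le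
    gcongr
    exact hq.le
  obtain ⟨ξ, hξ⟩ := cauchySeq_tendsto_of_complete hcauchy
  refine ⟨ξ, le_of_tendsto' hξ.norm fun j => (D j).norm_lt.le,
    ⟨⟨m, fun j => e (m j), D, hm2, hms, fun j => he2 _, fun j => he3 _, fun j => ?_⟩⟩⟩
  have h1 : Filter.Tendsto (fun n => ‖a (j + 1 + n) - a j‖) Filter.atTop
      (nhds ‖ξ - a j‖) := by
    have h := ((Filter.tendsto_add_atTop_iff_nat (j + 1)).mpr hξ).sub_const (D j).α
    simp only [add_comm _ (j + 1)] at h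
    exact h.norm
  simp only [hfar] at h1
  exact tendsto_nhds_unique h1 tendsto_const_nhds

/-! ### The exponents of ξ -/

namespace QuadraticApprox

variable {ξ : F⸨X⸩} {K : ℕ} {δ : ℝ} (S : QuadraticApprox ξ K δ)

/-- The logarithm to the base `q` of the height of the `j`-th polynomial. -/
def h (j : ℕ) : ℕ := 2 * S.m j + S.d j

lemma m_succ' (j : ℕ) : S.m (j + 1) = K * S.h j := S.m_succ j

lemma log_card_pos (F : Type*) [Field F] [Finite F] : 0 < Real.log (Nat.card F) :=
  Real.log_pos (one_lt_card_real F)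

lemma sub_ne_zero' (j : ℕ) : ξ - (S.D j).α ≠ 0 := by
  have := one_lt_card_real F
  rw [← norm_pos_iff, S.norm_sub]
  positivity

lemma log_norm_sub (j : ℕ) :
    Real.log ‖ξ - (S.D j).α‖ = (1 - K * S.h j) * Real.log (Nat.card F) := by
  have := one_lt_card_real F
  rw [S.norm_sub, Real.log_div (by positivity) (by positivity), Real.log_pow, S.m_succ']
  push_cast
  ring

/-- Since Kh - 1 > 2m, the series ξ sees the conjugate at the distance between the two roots. -/
lemma norm_sub_lt (hK : 2 ≤ K) (j : ℕ) : ‖ξ - (S.D j).α‖ < ‖(S.D j).α - (S.D j).α'‖ := by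
  have hq := one_lt_card_real F
  rw [S.norm_sub, (S.D j).norm_sub, div_lt_iff₀ (by positivity), ← div_eq_inv_mul,
    lt_div_iff₀ (by positivity), ← pow_succ']
  apply pow_lt_pow_right₀ hq
  have := S.two_le j
  rw [S.m_succ]
  nlinarith [Nat.zero_le (S.d j)]

lemma norm_sub_conj (hK : 2 ≤ K) (j : ℕ) :
    ‖ξ - (S.D j).α'‖ = ‖(S.D j).α - (S.D j).α'‖ := by
  have : ξ - (S.D j).α' = ((S.D j).α - (S.D j).α') + (ξ - (S.D j).α) := by ring
  rw [this, norm_add_eq_left (S.norm_sub_lt hK j)]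

lemma eval_ne_zero (hK : 2 ≤ K) (j : ℕ) : (S.D j).poly.eval₂ polyEmb ξ ≠ 0 := by
  have h := S.norm_sub_conj hK j
  rw [CloseQuadratic.eval_poly]
  refine mul_ne_zero ((map_ne_zero_iff _ polyEmb_injective).mpr (S.D j).a_ne_zero)
    (mul_ne_zero (S.sub_ne_zero' j) ?_)
  rw [← norm_pos_iff, h]
  exact (norm_nonneg _).trans_lt (S.norm_sub_lt hK j)

/-- The value factors as |a||ξ - α||ξ - α'|, with sizes q^(2m + d), q^(1 - Kh) and q^(-2m). -/
lemma log_norm_eval (hK : 2 ≤ K) (j : ℕ) :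
    Real.log ‖(S.D j).poly.eval₂ polyEmb ξ‖ = (1 + S.d j - K * S.h j) * Real.log (Nat.card F) := by
  have hq := one_lt_card_real F
  have h0 := S.sub_ne_zero' j
  rw [CloseQuadratic.eval_poly, norm_mul, norm_mul, S.norm_sub_conj hK, (S.D j).norm_a,
    (S.D j).norm_sub, Real.log_mul (by positivity) (by positivity),
    Real.log_mul (by positivity) (by positivity), S.log_norm_sub, Real.log_inv, Real.log_pow,
    Real.log_pow]
  push_cast
  ring

lemma strictMono_h (hK : 2 ≤ K) : StrictMono S.h := by
  apply strictMono_nat_of_lt_succ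
  intro j
  have := S.m_succ' j
  have h2 := S.two_le (j + 1)
  have h3 : S.h (j + 1) = 2 * S.m (j + 1) + S.d (j + 1) := rfl
  nlinarith [Nat.zero_le (S.h j)]

/-- Together with m_(j+1) = K h_j, this bounds h_(j+1) linearly in h_j, so the heights q^h leave no
gap too wide for the resultant argument. -/
lemma h_mul_le (j : ℕ) : δ * S.h j ≤ 2 * S.m j + 2 := by
  have h1 := S.d_le j
  have h3 : (S.h j : ℝ) = 2 * S.m j + S.d j := by simp [h]
  rw [h3]
  linarith

lemma d_ge (j : ℕ) : (1 - δ) * S.h j ≤ S.d j := by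
  have h1 := S.le_d j
  have h3 : (S.h j : ℝ) = 2 * S.m j + S.d j := by simp [h]
  rwa [h3]

lemma d_le' (j : ℕ) : S.d j ≤ (1 - δ) * S.h j + 2 := by
  have h1 := S.d_le j
  have h3 : (S.h j : ℝ) = 2 * S.m j + S.d j := by simp [h]
  rwa [h3]

lemma height_poly (j : ℕ) : (height (S.D j).poly : ℝ) = (Nat.card F : ℝ) ^ S.h j :=
  (S.D j).height_poly

/-- Polynomials that are not multiples of the given ones do not take very small values. -/
lemma neg_log_norm_eval_le (hξ : ‖ξ‖ ≤ 1) (hδ : 0 < δ) (hδ1 : δ ≤ 1) (hK : 16 / δ + 2 ≤ K)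
    {Q : F[X][X]} (hQ0 : Q ≠ 0) (hQ : Q.natDegree ≤ 2)
    (hne : ∀ j g, Q ≠ Polynomial.C g * (S.D j).poly) :
    Q.eval₂ polyEmb ξ ≠ 0 ∧ -Real.log ‖Q.eval₂ polyEmb ξ‖ ≤
      (K - 1) * Real.log (height Q) + (2 * S.h 0 + 12 / δ) * Real.log (Nat.card F) := by
  have hq := one_lt_card_real F
  have hl := log_card_pos F
  have hδ16 : 16 ≤ 16 / δ := by rw [le_div_iff₀ hδ]; linarith
  have hK4 : 4 ≤ K := by
    have : (4 : ℝ) ≤ K := by linarith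
    exact_mod_cast this
  have hmono := S.strictMono_h (by omega)
  obtain ⟨k, hk⟩ := exists_height_eq_pow hQ0
  -- This is the condition 2h + 2k + 1 < Kh under which `one_le_mul_norm_eval` applies to Q; it
  -- yields |Q(ξ)| ≥ q^(-2h - k), so the first such j is the best choice.
  have hex : ∃ j, 2 * k + 1 < (K - 2) * S.h j := by
    refine ⟨2 * k + 2, ?_⟩
    have h1 : 2 * k + 2 ≤ S.h (2 * k + 2) := hmono.le_apply
    have h2 : 1 ≤ K - 2 := by omega
    nlinarith
  obtain ⟨j, hj, hbound⟩ : ∃ j, 2 * k + 1 < (K - 2) * S.h j ∧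
      (2 * S.h j + k : ℝ) ≤ (K - 1) * k + (2 * S.h 0 + 12 / δ) := by
    classical
    refine ⟨Nat.find hex, Nat.find_spec hex, ?_⟩
    rcases hfind : Nat.find hex with _ | i
    · have : (1 : ℝ) * k ≤ (K - 1) * k := by gcongr; linarith
      have : 0 ≤ 12 / δ := by positivity
      linarith
    · have hi := Nat.find_min hex (m := i) (by omega)
      have h1 : (K - 2) * (S.h i : ℝ) ≤ 2 * k + 1 := by
        have : (((K - 2 : ℕ) : ℝ)) * (S.h i : ℝ) ≤ 2 * k + 1 := by exact_mod_cast not_lt.mp hi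
        rwa [Nat.cast_sub (by omega), Nat.cast_ofNat] at this
      have h2 := S.h_mul_le (i + 1)
      rw [S.m_succ', Nat.cast_mul] at h2
      have h3 : (K : ℝ) * S.h i ≤ 2 * (2 * k + 1) := by
        have : (K : ℝ) * S.h i ≤ 2 * ((K - 2) * S.h i) := by
          rw [← mul_assoc]
          gcongr
          have : (4 : ℝ) ≤ K := by exact_mod_cast hK4
          linarith
        linarith
      have h4 : (S.h (i + 1) : ℝ) ≤ (8 * k + 6) / δ := by
        rw [le_div_iff₀ hδ]; linarith
      have h5 : (16 / δ + 1) * (k : ℝ) ≤ (K - 1) * k := by gcongr; linarith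
      have h6 : 2 * ((8 * k + 6) / δ) = 16 / δ * k + 12 / δ := by ring
      have h7 : (0 : ℝ) ≤ 2 * S.h 0 := by positivity
      linarith
  have hlow := (S.D j).one_le_mul_norm_eval hQ (hne j) hξ (by
    rw [(S.D j).norm_a, hk, S.norm_sub, ← pow_mul, ← pow_mul, mul_div_assoc', ← pow_succ,
      mul_div_assoc', ← pow_add, div_lt_one (by positivity)]
    apply pow_lt_pow_right₀ hq
    rw [S.m_succ']
    obtain ⟨K', rfl⟩ := Nat.exists_eq_add_of_le (by omega : 2 ≤ K)
    rw [Nat.add_sub_cancel_left] at hj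
    change (S.h j) * 2 + (k * 2 + 1) < _
    nlinarith)
  have hne0 : Q.eval₂ polyEmb ξ ≠ 0 := by
    intro h0
    rw [h0, norm_zero, mul_zero, mul_zero] at hlow
    linarith
  refine ⟨hne0, ?_⟩
  have hlog := Real.log_le_log one_pos hlow
  rw [Real.log_one, (S.D j).norm_a, hk, Real.log_mul (by positivity) (by positivity),
    Real.log_mul (by positivity) (by positivity), Real.log_pow, Real.log_pow, Real.log_pow] at hlog
  rw [hk, Real.log_pow]
  have hh : ((2 * S.m j + S.d j : ℕ) : ℝ) = S.h j := rfl
  rw [hh] at hlog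
  have := mul_le_mul_of_nonneg_right hbound hl.le
  push_cast at hlog
  linarith

lemma h_mul_log_le (S : QuadraticApprox ξ K δ) {j H : ℕ} {Q : F[X][X]} {g : F[X]} (hQ0 : Q ≠ 0)
    (hQ : Q = Polynomial.C g * (S.D j).poly) (hH : (height Q : ℝ) ≤ H) :
    S.h j * Real.log (Nat.card F) ≤ Real.log H := by
  have hq := one_lt_card_real F
  rw [← Real.log_pow, ← S.height_poly]
  apply Real.log_le_log
  · rw [S.height_poly]; positivity
  · exact (height_le_of_dvd hQ0 (hQ ▸ dvd_mul_left _ _)).trans hH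

/-- A nonzero multiple of P_j has height at least q^h and a value at ξ no smaller than that of P_j;
every other polynomial yields only the exponent K - 1. -/
theorem mahlerExp_le (S : QuadraticApprox ξ K δ) (hξ : ‖ξ‖ ≤ 1) (hδ : 0 < δ) (hδ1 : δ ≤ 1)
    (hK : 16 / δ + 2 ≤ K) : mahlerExp 2 ξ ≤ ((K - 1 + δ : ℝ) : EReal) := by
  have hl := log_card_pos F
  have hK2 : (2 : ℝ) ≤ K := by
    have : 0 ≤ 16 / δ := by positivity
    linarith
  refine limsup_const_le _ ((2 * S.h 0 + 12 / δ) * Real.log (Nat.card F)) ?_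
  filter_upwards [Filter.eventually_ge_atTop 2] with H hH
  have hlog : 0 < Real.log H := Real.log_pos (by exact_mod_cast hH)
  obtain ⟨Q, h1, h2, h3, h4⟩ := exists_minPolyValue 2 ξ (by omega : 1 ≤ H)
  rw [h4, div_le_iff₀ hlog, add_mul, div_mul_cancel₀ _ hlog.ne']
  have hQ0 : Q ≠ 0 := by rintro rfl; simp at h3
  have hc : 0 ≤ (2 * S.h 0 + 12 / δ) * Real.log (Nat.card F) := by positivity
  by_cases hne : ∀ j g, Q ≠ Polynomial.C g * (S.D j).poly
  · refine (S.neg_log_norm_eval_le hξ hδ hδ1 hK hQ0 h2 hne).2.trans ?_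
    have h5 : Real.log (height Q) ≤ Real.log H :=
      Real.log_le_log (by linarith [one_le_height hQ0]) h1
    have h6 : (K - 1 : ℝ) * Real.log (height Q) ≤ (K - 1 + δ) * Real.log H := by
      apply mul_le_mul _ h5 (Real.log_nonneg (one_le_height hQ0)) <;> linarith
    linarith
  · push Not at hne
    obtain ⟨j, g, hQ⟩ := hne
    have h5 := S.h_mul_log_le hQ0 hQ h1
    have hg : g ≠ 0 := by rintro rfl; simp [hQ] at hQ0
    have hP := S.eval_ne_zero (by exact_mod_cast hK2) j
    have h6 : Real.log ‖(S.D j).poly.eval₂ polyEmb ξ‖ ≤ Real.log ‖Q.eval₂ polyEmb ξ‖ := by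
      apply Real.log_le_log (norm_pos_iff.mpr hP)
      rw [hQ, Polynomial.eval₂_mul, Polynomial.eval₂_C, norm_mul]
      exact le_mul_of_one_le_left (norm_nonneg _) (one_le_norm_polyEmb hg)
    rw [S.log_norm_eval (by exact_mod_cast hK2)] at h6
    have h7 : (K * S.h j - 1 - S.d j : ℝ) * Real.log (Nat.card F) ≤
        (K - 1 + δ) * S.h j * Real.log (Nat.card F) := by
      gcongr
      linarith [S.d_ge j]
    have h8 : (K - 1 + δ) * (S.h j * Real.log (Nat.card F)) ≤ (K - 1 + δ) * Real.log H := by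
      gcongr
      linarith
    linarith

lemma tendsto_card_pow_h (S : QuadraticApprox ξ K δ) (hK : 2 ≤ K) :
    Filter.Tendsto (fun j => Nat.card F ^ S.h j) Filter.atTop Filter.atTop :=
  (tendsto_pow_atTop_atTop_of_one_lt Finite.one_lt_card).comp (S.strictMono_h hK).tendsto_atTop

theorem le_mahlerExp (S : QuadraticApprox ξ K δ) (hK : 2 ≤ K) :
    ((K - 1 + δ : ℝ) : EReal) ≤ mahlerExp 2 ξ := by
  have hl := log_card_pos F
  -- The 3 combines the 1 in |ξ - α_j| = q^(1 - Kh) with the rounding error 2 in d.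
  refine le_limsup_of_subseq _ (S.tendsto_card_pow_h hK) (3 * Real.log (Nat.card F)) ?_
  filter_upwards [Filter.eventually_ge_atTop 1] with j hj
  have hh : 0 < S.h j := lt_of_lt_of_le hj (S.strictMono_h hK).le_apply
  have hh' : (0 : ℝ) < S.h j := by exact_mod_cast hh
  have hpos : 1 ≤ Nat.card F ^ S.h j := Nat.one_le_pow _ _ Nat.card_pos
  have h1 := minPolyValue_le (n := 2) (ξ := ξ) (H := Nat.card F ^ S.h j) (P := (S.D j).poly)
    (by rw [S.height_poly]; push_cast; rfl) (S.D j).natDegree_poly_le (S.eval_ne_zero hK j)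
  have h2 := Real.log_le_log (minPolyValue_pos 2 ξ hpos) h1
  rw [S.log_norm_eval hK] at h2
  push_cast at h2 ⊢
  rw [Real.log_pow, sub_le_iff_le_add, ← add_div, le_div_iff₀ (by positivity)]
  have h3 : (1 + S.d j - K * S.h j : ℝ) * Real.log (Nat.card F) ≤
      (3 - (K - 1 + δ) * S.h j) * Real.log (Nat.card F) := by
    refine mul_le_mul_of_nonneg_right ?_ hl.le
    linarith [S.d_le' j]
  linarith

/-- A root of a multiple of P_j is α_j or its conjugate, neither closer to ξ than α_j. For a root β
of any other Q within distance 1 of ξ, H|ξ - β| ≥ |Q(ξ)| reduces to the bound on values. -/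
theorem koksmaExp_le (S : QuadraticApprox ξ K δ) (hξ : ‖ξ‖ ≤ 1) (hδ : 0 < δ) (hδ1 : δ ≤ 1)
    (hK : 16 / δ + 2 ≤ K) : koksmaExp 2 ξ ≤ ((K - 1 : ℝ) : EReal) := by
  have hq := one_lt_card_real F
  have hl := log_card_pos F
  have hK2 : (2 : ℝ) ≤ K := by
    have : 0 ≤ 16 / δ := by positivity
    linarith
  have hK2' : 2 ≤ K := by exact_mod_cast hK2
  refine limsup_const_le _ ((2 * S.h 0 + 12 / δ) * Real.log (Nat.card F)) ?_
  filter_upwards [Filter.eventually_ge_atTop 2] with H hH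
  have hlog : 0 < Real.log H := Real.log_pos (by exact_mod_cast hH)
  have hH1 : (1 : ℝ) ≤ H := by exact_mod_cast (by omega : 1 ≤ H)
  obtain ⟨Q, β, hQ0, hβ, h1, h2, hβξ, h4⟩ := exists_minAlgDist (n := 2) (by norm_num) ξ
    (by omega : 1 ≤ H)
  rw [h4, div_le_iff₀ hlog, add_mul, div_mul_cancel₀ _ hlog.ne']
  have hc : 0 ≤ (2 * S.h 0 + 12 / δ) * Real.log (Nat.card F) := by positivity
  have hb0 : 0 < ‖toClosure ξ - β‖ := norm_pos_iff.mpr (sub_ne_zero.mpr hβξ.symm)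
  by_cases hne : ∀ j g, Q ≠ Polynomial.C g * (S.D j).poly
  · obtain ⟨hQξ, hlow⟩ := S.neg_log_norm_eval_le hξ hδ hδ1 hK hQ0 h2 hne
    rcases le_or_gt ‖toClosure ξ - β‖ 1 with hle | hgt
    · have hξ' : ‖toClosure ξ‖ ≤ 1 := by rwa [norm_algebraMap_closure]
      have hβ1 : ‖β‖ ≤ 1 := by
        have : β = toClosure ξ + -(toClosure ξ - β) := by ring
        rw [this]
        exact norm_add_le_of_le' hξ' (by rwa [norm_neg])
      have h5 := norm_eval₂_le h2 le_rfl hξ' hβ1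
      rw [hβ, sub_zero, eval₂_closureEmb, norm_algebraMap_closure, mul_one] at h5
      have h6 : ‖Q.eval₂ polyEmb ξ‖ ≤ H * ‖toClosure ξ - β‖ := h5.trans (by gcongr)
      have h7 := Real.log_le_log (norm_pos_iff.mpr hQξ) h6
      have h8 : Real.log (height Q) ≤ Real.log H :=
        Real.log_le_log (by linarith [one_le_height hQ0]) h1
      have h9 : (K - 1 : ℝ) * Real.log (height Q) ≤ (K - 1) * Real.log H := by
        gcongr
        linarith
      linarith
    · have h5 : 0 ≤ Real.log (H * ‖toClosure ξ - β‖) :=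
        Real.log_nonneg (one_le_mul_of_one_le_of_one_le hH1 hgt.le)
      have h6 : 0 ≤ (K - 1 : ℝ) * Real.log H := mul_nonneg (by linarith) hlog.le
      linarith
  · push Not at hne
    obtain ⟨j, g, hQ⟩ := hne
    have h5 := S.h_mul_log_le hQ0 hQ h1
    have hg : g ≠ 0 := by rintro rfl; simp [hQ] at hQ0
    have h6 : ‖ξ - (S.D j).α‖ ≤ ‖toClosure ξ - β‖ := by
      rw [hQ, Polynomial.eval₂_mul, Polynomial.eval₂_C, mul_eq_zero,
        map_eq_zero_iff _ closureEmb_injective, CloseQuadratic.eval_closure_poly, mul_eq_zero,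
        map_eq_zero_iff _ closureEmb_injective, mul_eq_zero, sub_eq_zero, sub_eq_zero] at hβ
      rcases (hβ.resolve_left hg).resolve_left (S.D j).a_ne_zero with rfl | rfl
      · rw [← map_sub, norm_algebraMap_closure]
      · rw [← map_sub, norm_algebraMap_closure, S.norm_sub_conj hK2']
        exact (S.norm_sub_lt hK2' j).le
    have h7 := Real.log_le_log (norm_pos_iff.mpr (S.sub_ne_zero' j)) h6
    rw [S.log_norm_sub] at h7
    rw [Real.log_mul (by positivity) hb0.ne']
    have h8 : (K : ℝ) * (S.h j * Real.log (Nat.card F)) ≤ K * Real.log H := by gcongr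
    linarith

theorem le_koksmaExp (S : QuadraticApprox ξ K δ) (hK : 2 ≤ K) :
    ((K - 1 : ℝ) : EReal) ≤ koksmaExp 2 ξ := by
  have hq := one_lt_card_real F
  have hl := log_card_pos F
  refine le_limsup_of_subseq _ (S.tendsto_card_pow_h hK) (Real.log (Nat.card F)) ?_
  filter_upwards [Filter.eventually_ge_atTop 1] with j hj
  have hh : 0 < S.h j := lt_of_lt_of_le hj (S.strictMono_h hK).le_apply
  have hh' : (0 : ℝ) < S.h j := by exact_mod_cast hh
  have hpos : 1 ≤ Nat.card F ^ S.h j := Nat.one_le_pow _ _ Nat.card_pos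
  have h1 := minAlgDist_le (n := 2) (ξ := ξ) (H := Nat.card F ^ S.h j)
    (α := toClosure (S.D j).α) (S.D j).poly_ne_zero (by simp [CloseQuadratic.eval_closure_poly])
    (by rw [S.height_poly]; push_cast; rfl) (S.D j).natDegree_poly_le
    (fun h => S.sub_ne_zero' j (sub_eq_zero.mpr (toClosure.injective h).symm))
  rw [← map_sub, norm_algebraMap_closure] at h1
  have hk := minAlgDist_pos (n := 2) (by norm_num) ξ hpos
  have h2 := Real.log_le_log hk h1
  rw [S.log_norm_sub] at h2
  rw [Real.log_mul (by positivity) hk.ne']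
  push_cast at h2 ⊢
  rw [Real.log_pow, sub_le_iff_le_add, ← add_div, le_div_iff₀ (by positivity)]
  linarith

end QuadraticApprox

/-- A nonzero P(0) is an element of F[T], so its absolute value is at least 1. This supplies the
difference 0, which the construction with δ > 0 does not reach. -/
lemma mahlerExp_zero : mahlerExp 2 (0 : F⸨X⸩) = 0 := by
  apply le_antisymm _ ((koksmaExp_nonneg 0).trans (koksmaExp_le_mahlerExp 0))
  rw [← EReal.coe_zero]
  refine limsup_const_le 0 0 ?_
  filter_upwards [Filter.eventually_ge_atTop 2] with H hH
  obtain ⟨P, -, h2, h3, h4⟩ := exists_minPolyValue 2 (0 : F⸨X⸩) (by omega : 1 ≤ H)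
  rw [zero_div, zero_add, h4]
  apply div_nonpos_of_nonpos_of_nonneg _ (Real.log_natCast_nonneg H)
  rw [neg_nonpos]
  apply Real.log_nonneg
  rw [Polynomial.eval₂_at_zero] at h3 ⊢
  exact one_le_norm_polyEmb (by rintro h; simp [h] at h3)

lemma koksmaExp_zero : koksmaExp 2 (0 : F⸨X⸩) = 0 :=
  le_antisymm ((koksmaExp_le_mahlerExp 0).trans mahlerExp_zero.le) (koksmaExp_nonneg 0)

/-- Every `δ` in `(0, 1]` is the difference of the two exponents of some series. -/
theorem exists_exponents (F : Type*) [Field F] [Finite F] {δ : ℝ} (hδ : 0 < δ) (hδ1 : δ ≤ 1) :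
    ∃ (ξ : F⸨X⸩) (w : ℝ), mahlerExp 2 ξ = ((w + δ : ℝ) : EReal) ∧ koksmaExp 2 ξ = (w : EReal) := by
  obtain ⟨K, hK⟩ := exists_nat_ge (16 / δ + 2)
  have hK2 : 2 ≤ K := by
    have : 0 ≤ 16 / δ := by positivity
    have : (2 : ℝ) ≤ K := by linarith
    exact_mod_cast this
  obtain ⟨ξ, hξ, ⟨S⟩⟩ := exists_quadraticApprox F (by omega : 1 ≤ K) hδ hδ1
  exact ⟨ξ, K - 1, le_antisymm (S.mahlerExp_le hξ hδ hδ1 hK) (S.le_mahlerExp hK2),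
    le_antisymm (S.koksmaExp_le hξ hδ hδ1 hK) (S.le_koksmaExp hK2)⟩

end LaurentExponents

end

theorem corollary1p3 (F : Type*) [Field F] [Finite F] :
    (∀ ξ : F⸨X⸩, 0 ≤ LaurentExponents.mahlerExp 2 ξ ∧ 0 ≤ LaurentExponents.koksmaExp 2 ξ ∧
      (LaurentExponents.mahlerExp 2 ξ = ⊤ ↔ LaurentExponents.koksmaExp 2 ξ = ⊤)) ∧
    {δ : ℝ | ∃ (ξ : F⸨X⸩) (w w' : ℝ), LaurentExponents.mahlerExp 2 ξ = (w : EReal) ∧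
      LaurentExponents.koksmaExp 2 ξ = (w' : EReal) ∧ δ = w - w'} = Set.Icc 0 1 := by
  refine ⟨fun ξ => ?_, ?_⟩
  · have h1 := LaurentExponents.koksmaExp_nonneg ξ
    have h2 := LaurentExponents.koksmaExp_le_mahlerExp ξ
    have h3 := LaurentExponents.mahlerExp_le_koksmaExp_add_one ξ
    refine ⟨h1.trans h2, h1, fun h => ?_, fun h => top_le_iff.mp (h ▸ h2)⟩
    by_contra hne
    rw [h, top_le_iff] at h3
    exact EReal.add_ne_top hne (EReal.coe_ne_top 1) h3
  · ext δ
    constructor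
    · rintro ⟨ξ, w, w', hw, hw', rfl⟩
      have h2 := LaurentExponents.koksmaExp_le_mahlerExp ξ
      have h3 := LaurentExponents.mahlerExp_le_koksmaExp_add_one ξ
      rw [hw, hw'] at h2 h3
      rw [EReal.coe_le_coe_iff] at h2
      rw [← EReal.coe_one, ← EReal.coe_add, EReal.coe_le_coe_iff] at h3
      constructor <;> linarith
    · rintro ⟨h0, h1⟩
      rcases h0.eq_or_lt with rfl | h0
      · exact ⟨0, 0, 0, LaurentExponents.mahlerExp_zero, LaurentExponents.koksmaExp_zero, by simp⟩
      · obtain ⟨ξ, w, hw, hw'⟩ := LaurentExponents.exists_exponents F h0 h1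
        exact ⟨ξ, w + δ, w, hw, hw', by ring⟩
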